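/- **Setting.** Let $V=\{1,\dots,N\}$, let $\mathbf A=(\alpha_{ij})_{i,j\in V}$ be a (row-)stochastic matrix, and let $(r_n)_{n\ge 0}\subset(0,1)$ satisfy $\sum_n r_n=+\infty$, $\sum_n r_n^2<+\infty$. Each agent $i\in V$ is either *cooperative* or *competitive*. On a probability space with a filtration $(\mathcal F_n)_{n\ge0}$, let the states $Z_n(i)\in[0,1]$ and the driving variables $Y_{n+1}(i)\in\{0,1\}$ be such that $Z_0(i)$ is $\mathcal F_0$-measurable, $Y_{n+1}(i)$ is $\mathcal F_{n+1}$-measurable and, for all $n\ge0$, $i\in V$, $$Z_{n+1}(i)=(1-r_n)Z_n(i)+r_nY_{n+1}(i),\qquad P\big(Y_{n+1}(i)=1\mid\mathcal F_n\big)=\alpha_{ii}Z_n(i)+\sum_{j\ne i}\alpha_{ij}X_n^{i}(j)\quad\text{a.s.},$$ where $X_n^{i}(j)=Z_n(j)$ if $i$ is cooperative and $X_n^{i}(j)=1-Z_n(j)$ if $i$ is competitive. **Hierarchical representation.** Let $G$ be the oriented graph on $V$ with an edge $(i,j)$ iff $i\neq j$ and $\alpha_{ij}\ne0$. Two agents communicate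 if there are oriented paths from each to the other (every agent communicates with itself); a communicating class is an equivalence class of this relation. A class of level $0$ is a communicating class $R$ with $\alpha_{ij}=0$ for all $i\in R$, $j\notin R$. For $m\ge1$, a class of level $m$ is a communicating class $T$ such that $\alpha_{ij}=0$ whenever $i\in T$ and $j$ lies neither in $T$ nor in a class of level at most $m-1$, and such that $\alpha_{ij}>0$ for some $i\in T$ and some $j\notin T$ belonging to a class of level $m-1$. Denote the classes of level $0$ by $R_\ell=T_{0,\ell}$ $(1\le\ell\le k_0)$ and the classes of level $m\ge1$ by $T_{m,h}$ $(1\le h\le k_m)$. For a vector indexed by $V$, the restrictions to $R_\ell$ and $T_{m,h}$ are denoted by $\mathbf Z^{(\ell)}=\mathbf U^{(0,\ell)}$ and $\mathbf U^{(m,h)}$. Put $\mathbf A_{m,h}=(\alpha_{ij})_{i,j\in T_{m,h}}$ and $\mathbf B_{(m,h)}^{(t,s)}=(\alpha_{ij})_{i\in T_{m,h},\,j\in T_{t,s}}$. A level-$0$ class $R_\ell$ is called bipartite if $R_\ell=I\sqcup J$ with every edge of $G$ inside $R_\ell$ joining $I$ and $J$ (one side may be empty, so a one-point class is bipartite). **Theorem.**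 Assume that all agents in each class have the same attitude (so that each class is cooperative or competitive). Then every agent belongs to exactly one class $T_{m,h}$, the vector $\bar{\mathbf Z}_n=(Z_n(i))_{i\in V}$ converges a.s. to a random vector $\bar{\mathbf Z}_\infty$, and: 1. If $R_\ell$ is cooperative, then a.s. $\mathbf Z^{(\ell)}_\infty=(Z^{(\ell)}_\infty,\dots,Z^{(\ell)}_\infty)$ for a random variable $Z^{(\ell)}_\infty$. 2. If $R_\ell$ is competitive and bipartite with bipartition $I\sqcup J$, then there is a random variable $Z^{(\ell)}_\infty$ such that a.s. $Z_\infty(i)=Z^{(\ell)}_\infty$ for $i\in I$ and $Z_\infty(j)=1-Z^{(\ell)}_\infty$ for $j\in J$. 3. In cases 1 and 2, assume in addition that, for every $n$, the variables $Y_{n+1}(i)$, $i\in R_\ell$, are conditionally independent given $\mathcal F_n$, and that the initial state on $R_\ell$ is not trivial, i.e. it is not a.s. equal to one of the two absorbing configurations (in case 1: all states $0$, respectively all states $1$; in case 2: $0$ on $I$ and $1$ on $J$, respectively $1$ on $I$ and $0$ on $J$). Then $P(Z^{(\ell)}_\infty=x)<1$ for every $x$. 4. If $R_\ell$ is competitive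 and not bipartite, then $\mathbf Z^{(\ell)}_\infty=(\tfrac12,\dots,\tfrac12)$ a.s. 5. For every class $T_{m,h}$ of level $m\ge1$ the matrix $\mathbf K_{(m,h)}$ below is invertible and a.s. $$\mathbf U^{(m,h)}_\infty=-\mathbf K_{(m,h)}^{-1}\Big(\mathbf c^{(m,h)}+\sum_{\ell=1}^{k_0}\widetilde{\mathbf B}_{(m,h)}^{(0,\ell)}\mathbf Z^{(\ell)}_\infty+\sum_{t=1}^{m-1}\sum_{s=1}^{k_t}\widetilde{\mathbf B}_{(m,h)}^{(t,s)}\mathbf U^{(t,s)}_\infty\Big),$$ where $\mathbf K_{(m,h)}=2\,\mathrm{diag}(\mathbf A_{m,h})-\mathbf I-\mathbf A_{m,h}$, $\mathbf c^{(m,h)}=(1-\alpha_{ii})_{i\in T_{m,h}}$, $\widetilde{\mathbf B}_{(m,h)}^{(t,s)}=-\mathbf B_{(m,h)}^{(t,s)}$ if $T_{m,h}$ is competitive, and $\mathbf K_{(m,h)}=\mathbf A_{m,h}-\mathbf I$, $\mathbf c^{(m,h)}=\mathbf 0$, $\widetilde{\mathbf B}_{(m,h)}^{(t,s)}=\mathbf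 B_{(m,h)}^{(t,s)}$ if $T_{m,h}$ is cooperative. -/

import Mathlib

open MeasureTheory ProbabilityTheory Filter
open scoped Topology Matrix

noncomputable section

namespace ReinforcedNetwork

/-- The attitude of an agent towards its neighbours. -/
inductive Attitude
  | cooperative
  | competitive

/-! ### The interaction graph and its hierarchical representation -/

section Graph

variable {V : Type*}

/-- The oriented graph of the interaction matrix `A`: there is an edge `(i, j)` if and only if
`i ≠ j` and `A i j ≠ 0`. -/
def interactionGraph (A : Matrix V V ℝ) : Digraph V where
  Adj i j := i ≠ j ∧ A i j ≠ 0

/-- `i` and `j` communicate: there are oriented paths from `i` to `j` and from `j` to `i`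
(an agent communicates with itself through the empty path). -/
def Communicate (A : Matrix V V ℝ) (i j : V) : Prop :=
  Relation.ReflTransGen (interactionGraph A).Adj i j ∧
    Relation.ReflTransGen (interactionGraph A).Adj j i

/-- A class of communicating agents: an equivalence class of the relation `Communicate`. -/
def IsCommunicatingClass (A : Matrix V V ℝ) (T : Finset V) : Prop :=
  T.Nonempty ∧ ∀ i ∈ T, ∀ j, j ∈ T ↔ Communicate A i j

/-- `IsLevelClass A m T`: the set `T` is a class of level `m`.
* The classes of level `0` are the closed communicating classes.
* The classes of level `m + 1` are the communicating classes that have no edge to an agent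
  outside the class and outside all the classes of level at most `m`, and that have at least one
  edge to an agent (outside the class) belonging to a class of level `m`. -/
def IsLevelClass (A : Matrix V V ℝ) : ℕ → Finset V → Prop
  | 0, T => IsCommunicatingClass A T ∧ ∀ i ∈ T, ∀ j, j ∉ T → A i j = 0
  | m + 1, T => IsCommunicatingClass A T ∧
      (∀ i ∈ T, ∀ j, j ∉ T →
        (∀ s, ∀ _ : s ≤ m, ∀ S, IsLevelClass A s S → j ∉ S) → A i j = 0) ∧
      ∃ i ∈ T, ∃ j, j ∉ T ∧ (∃ S, IsLevelClass A m S ∧ j ∈ S) ∧ 0 < A i j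
termination_by m => m

open Classical in
/-- The finite collection of all classes of level `m`. -/
def levelClasses [Fintype V] (A : Matrix V V ℝ) (m : ℕ) : Finset (Finset V) :=
  Finset.univ.filter (IsLevelClass A m)

/-- `I` and `J` are the two sides of a bipartition of the subgraph induced on `R`: they partition
`R`, and every edge between two agents of `R` has its endpoints on different sides. One side may
be empty, so a one-vertex graph is bipartite. -/
def IsBipartition (A : Matrix V V ℝ) (R I J : Finset V) : Prop :=
  (∀ i, i ∈ R ↔ i ∈ I ∨ i ∈ J) ∧ Disjoint I J ∧
    ∀ i ∈ R, ∀ j ∈ R, (interactionGraph A).Adj i j → (i ∈ I ∧ j ∈ J) ∨ (i ∈ J ∧ j ∈ I)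

/-- The subgraph induced on `R` is bipartite. -/
def IsBipartiteOn (A : Matrix V V ℝ) (R : Finset V) : Prop :=
  ∃ I J, IsBipartition A R I J

end Graph

/-! ### The dynamics -/

section Dynamics

variable {V : Type*} [Fintype V] [DecidableEq V]

/-- The contribution of the state `x` of a neighbour: `x` for a cooperative agent, `1 - x` for a
competitive one. -/
def perceived : Attitude → ℝ → ℝ
  | .cooperative, x => x
  | .competitive, x => 1 - x

/-- The conditional probability that the next driving variable of agent `i` equals `1`, given
that the current vector of states is `z`. -/
def successProb (A : Matrix V V ℝ) (att : V → Attitude) (z : V → ℝ) (i : V) : ℝ :=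
  A i i * z i + ∑ j ∈ Finset.univ.erase i, A i j * perceived (att i) (z j)

/-- `(Z, Y)` is a system of interacting reinforced stochastic processes with interaction matrix
`A`, attitudes `att` and step sizes `r`, with respect to the filtration `ℱ`. Here `Z n ω i` is the
state of agent `i` at time `n` and `Y (n + 1) ω i` is its driving variable at time `n + 1`. -/
structure IsReinforcedSystem {Ω : Type*} {mΩ : MeasurableSpace Ω} (μ : Measure Ω)
    (ℱ : Filtration ℕ mΩ) (A : Matrix V V ℝ) (att : V → Attitude) (r : ℕ → ℝ)
    (Z Y : ℕ → Ω → V → ℝ) : Prop where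
  init_measurable : ∀ i, Measurable[ℱ 0] fun ω => Z 0 ω i
  init_mem : ∀ ω i, Z 0 ω i ∈ Set.Icc (0 : ℝ) 1
  driving_measurable : ∀ n i, Measurable[ℱ (n + 1)] fun ω => Y (n + 1) ω i
  driving_mem : ∀ n ω i, Y (n + 1) ω i = 0 ∨ Y (n + 1) ω i = 1
  step : ∀ n ω i, Z (n + 1) ω i = (1 - r n) * Z n ω i + r n * Y (n + 1) ω i
  driving_prob : ∀ n i,
    μ⟦{ω | Y (n + 1) ω i = 1} | ℱ n⟧ =ᵐ[μ] fun ω => successProb A att (Z n ω) i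

/-- Given the past, the next driving variables of the agents in `R` are independent: for all
`n`, the random variables `Y (n + 1) · i`, `i ∈ R`, are conditionally independent given `ℱ n`. -/
def CondIndepDriving {Ω : Type*} {mΩ : MeasurableSpace Ω} (μ : Measure Ω)
    (ℱ : Filtration ℕ mΩ) (Y : ℕ → Ω → V → ℝ) (R : Finset V) : Prop :=
  ∀ n, ∀ S ⊆ R, ∀ B : V → Set ℝ, (∀ i, MeasurableSet (B i)) →
    μ⟦⋂ i ∈ S, {ω | Y (n + 1) ω i ∈ B i} | ℱ n⟧
      =ᵐ[μ] ∏ i ∈ S, μ⟦{ω | Y (n + 1) ω i ∈ B i} | ℱ n⟧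

end Dynamics

/-! ### The blocks of the interaction matrix -/

section Blocks

variable {V : Type*} [DecidableEq V]

/-- The block of a vector indexed by the agents of `T`. -/
def blockVec (T : Finset V) (z : V → ℝ) : T → ℝ := fun i => z i

/-- The block `(A i j)_{i ∈ T, j ∈ S}` of the interaction matrix. -/
def block (A : Matrix V V ℝ) (T S : Finset V) : Matrix T S ℝ :=
  A.submatrix Subtype.val Subtype.val

/-- The matrix `K` of a class `T` of the given attitude: `A_T - I` for a cooperative class and
`2 diag(A_T) - I - A_T` for a competitive class, where `A_T` is the diagonal block of `T`. -/
def driftMatrix (A : Matrix V V ℝ) (T : Finset V) : Attitude → Matrix T T ℝ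
  | .cooperative => block A T T - 1
  | .competitive => (2 : ℝ) • Matrix.diagonal (block A T T).diag - 1 - block A T T

/-- The vector `c` of a class `T` of the given attitude. -/
def driftConst (A : Matrix V V ℝ) (T : Finset V) : Attitude → T → ℝ
  | .cooperative => 0
  | .competitive => fun i => 1 - A i i

/-- The signed block describing the influence of the class `S` on a class `T` of the given
attitude. -/
def influence (A : Matrix V V ℝ) (T S : Finset V) : Attitude → Matrix T S ℝ
  | .cooperative => block A T S
  | .competitive => -block A T S

end Blocks

end ReinforcedNetwork

end

open ReinforcedNetwork

/-! The dynamics is a stochastic approximation: `Z (n + 1) = Z n + r n * (p (Z n) - Z n) + r n * ξ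
n`, with `p` the vector of conditional probabilities and `ξ n` a bounded martingale difference.
Since the squares of the steps are summable, the weighted noises form an L²-bounded martingale, so
their series converges a.s. The question becomes deterministic, one trajectory at a time
(`IsTrajectory`): the drift is affine, and on a class it reads `K x + b n`, where `b n` depends only
on the classes of lower level.

Set `S = K + 1`. Its entries are those of the diagonal block of `A` up to sign, so its absolute row
sums are at most one. By the maximum principle a fixed vector of `S` has constant modulus, and this
modulus is zero as soon as an edge leaves the class. Hence `K` is invertible at positive level. At
level 0 with competition, the signs of a nonzero fixed vector would give a bipartition, so `K` is
also invertible in the non-bipartite case. When `K` is invertible, the lazy matrix `(1 + S) / 2` has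
spectrum in the open unit disc; a Gronwall argument in an adapted norm then forces convergence to
the zero of the limiting drift (`tendsto_of_affine_recursion`). Induction on the level settles these
classes.

The remaining level-0 classes become cooperative after centring at `1 / 2` and flipping signs on one
side (`IsSigning`). There `S` is stochastic and irreducible, with invariant law `v`: the `v`-mean
moves by the noise alone, hence converges, while the deviation from it contracts
(`tendsto_consensus_of_recursion`).

For non-degeneracy, the variance of the `v`-mean about a deterministic limit is nondecreasing in
time and tends to zero, so it vanishes throughout. Conditional independence makes the variance
increment a positive combination of the individual noise variances, so all the noises vanish. The
conditional probabilities are then 0 or 1 at two successive times, which forces an absorbing initial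
configuration. -/

namespace ReinforcedNetwork

/-! ### Perturbed contracting recursions -/

section Recursion

/-- A Gronwall-type lemma: a nonnegative sequence contracted at the non-summable rate `c * r n`,
up to an error negligible with respect to `r n`, tends to zero. -/
theorem tendsto_zero_of_le_contraction {a r ε : ℕ → ℝ} {c : ℝ} (hc : 0 < c) (ha : ∀ n, 0 ≤ a n)
    (hr : ∀ n, 0 ≤ r n)
    (hr_sum : Tendsto (fun n => ∑ k ∈ Finset.range n, r k) atTop atTop)
    (hε : Tendsto ε atTop (𝓝 0)) (hcr : ∀ᶠ n in atTop, c * r n ≤ 1)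
    (h : ∀ᶠ n in atTop, a (n + 1) ≤ (1 - c * r n) * a n + r n * ε n) :
    Tendsto a atTop (𝓝 0) := by
  rw [Metric.tendsto_atTop]
  intro δ hδ
  have hδ2 : 0 < δ / 2 := by positivity
  have hε' : ∀ᶠ n in atTop, ε n ≤ c * (δ / 2) :=
    (hε.eventually (gt_mem_nhds (show (0 : ℝ) < c * (δ / 2) by positivity))).mono
      fun n hn => hn.le
  obtain ⟨N, hN⟩ := eventually_atTop.1 (hcr.and (h.and hε'))
  set s : ℕ → ℝ := fun n => ∑ k ∈ Finset.range n, r k with hs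
  -- Once `ε n ≤ c * (δ / 2)`, the level `δ / 2` absorbs the error, so the excess above it contracts
  -- with no error term.
  set b : ℕ → ℝ := fun n => max (a n - δ / 2) 0 with hb
  have hb0 : ∀ n, 0 ≤ b n := fun n => le_max_right _ _
  have hstep : ∀ n, N ≤ n → b (n + 1) ≤ (1 - c * r n) * b n := by
    intro n hn
    obtain ⟨h1, h2, h3⟩ := hN n hn
    refine max_le ?_ (mul_nonneg (by linarith) (hb0 n))
    have h4 : a n - δ / 2 ≤ b n := le_max_left _ _
    have h5 := mul_le_mul_of_nonneg_left h4 (show 0 ≤ 1 - c * r n by linarith)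
    have h6 := mul_le_mul_of_nonneg_left h3 (hr n)
    nlinarith
  have hexp : ∀ n, N ≤ n → b n ≤ b N * Real.exp (c * s N) * Real.exp (-(c * s n)) := by
    intro n hn
    induction n, hn using Nat.le_induction with
    | base => rw [mul_assoc, ← Real.exp_add]; simp
    | succ n hn ih =>
      refine (hstep n hn).trans ?_
      have h1 : (1 - c * r n) ≤ Real.exp (-(c * r n)) := by
        have := Real.add_one_le_exp (-(c * r n)); linarith
      refine (mul_le_mul h1 ih (hb0 n) (Real.exp_pos _).le).trans (le_of_eq ?_)
      have h2 : s (n + 1) = s n + r n := Finset.sum_range_succ _ _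
      rw [h2, show -(c * (s n + r n)) = -(c * r n) + -(c * s n) by ring, Real.exp_add]
      ring
  have hlim : Tendsto (fun n => b N * Real.exp (c * s N) * Real.exp (-(c * s n))) atTop
      (𝓝 0) := by
    have h1 : Tendsto (fun n => -(c * s n)) atTop atBot :=
      tendsto_neg_atTop_atBot.comp (hr_sum.const_mul_atTop hc)
    simpa using (Real.tendsto_exp_atBot.comp h1).const_mul (b N * Real.exp (c * s N))
  obtain ⟨M, hM⟩ := eventually_atTop.1 (hlim.eventually (gt_mem_nhds hδ2))
  refine ⟨max N M, fun n hn => ?_⟩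
  have h1 := hexp n ((le_max_left _ _).trans hn)
  have h2 := hM n ((le_max_right _ _).trans hn)
  have h3 : a n - δ / 2 ≤ b n := le_max_left _ _
  rw [Real.dist_eq, sub_zero, abs_of_nonneg (ha n)]
  linarith

variable {E : Type*} [NormedAddCommGroup E] [NormedSpace ℝ E]

/-- A linear recursion relaxing towards a power-contracting map `f`, perturbed by vanishing
drifts, tends to zero. -/
theorem tendsto_zero_of_recursion_of_drift (f : E →L[ℝ] E) {k : ℕ} (hk : 0 < k)
    (hf : ∀ x, ‖(f ^ k) x‖ ≤ 1 / 2 * ‖x‖) {r : ℕ → ℝ} (hr : ∀ n, 0 ≤ r n)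
    (hr_sum : Tendsto (fun n => ∑ k ∈ Finset.range n, r k) atTop atTop)
    (hr_zero : Tendsto r atTop (𝓝 0)) {y d : ℕ → E} (hd : Tendsto d atTop (𝓝 0))
    (hy : ∀ n, y (n + 1) = y n + r n • ((2 : ℝ) • (f (y n) - y n) + d n)) :
    Tendsto y atTop (𝓝 0) := by
  -- Adapted norm: applying `f` shifts the sum, trading `‖x‖` for `‖(f ^ k) x‖ ≤ ‖x‖ / 2`. Thus `p`
  -- contracts in one step although the original norm may not.
  set p : E → ℝ := fun x => ∑ j ∈ Finset.range k, ‖(f ^ j) x‖ with hp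
  set C : ℝ := ∑ j ∈ Finset.range k, ‖f ^ j‖ with hC
  have hC0 : 0 ≤ C := Finset.sum_nonneg fun _ _ => norm_nonneg _
  have hp0 : ∀ x, 0 ≤ p x := fun x => Finset.sum_nonneg fun _ _ => norm_nonneg _
  have hpC : ∀ x, p x ≤ C * ‖x‖ := by
    intro x
    rw [hC, Finset.sum_mul]
    exact Finset.sum_le_sum fun j _ => (f ^ j).le_opNorm x
  have hle : ∀ x, ‖x‖ ≤ p x := by
    intro x
    have h0 := Finset.single_le_sum (f := fun j => ‖(f ^ j) x‖) (fun _ _ => norm_nonneg _)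
      (Finset.mem_range.2 hk)
    rwa [pow_zero, one_apply_eq_self] at h0
  have hadd : ∀ x z, p (x + z) ≤ p x + p z := by
    intro x z
    simp only [hp, map_add, ← Finset.sum_add_distrib]
    exact Finset.sum_le_sum fun j _ => norm_add_le _ _
  have hsmul : ∀ (c : ℝ) x, 0 ≤ c → p (c • x) = c * p x := by
    intro c x hc
    simp only [hp, map_smul, norm_smul, Real.norm_of_nonneg hc, Finset.mul_sum]
  -- Chosen so that `γ * p x` is at most the gain `‖x‖ / 2`; the added one keeps the denominator
  -- positive.
  set γ : ℝ := 1 / (2 * (C + 1)) with hγ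
  have hγ0 : 0 < γ := by positivity
  have hpf : ∀ x, p (f x) ≤ (1 - γ) * p x := by
    intro x
    have h1 : p (f x) = p x - ‖x‖ + ‖(f ^ k) x‖ := by
      have h2 : p (f x) = ∑ j ∈ Finset.range k, ‖(f ^ (j + 1)) x‖ := by
        simp only [hp, pow_succ]
        rfl
      have h3 := Finset.sum_range_succ (fun j => ‖(f ^ j) x‖) k
      have h4 := Finset.sum_range_succ' (fun j => ‖(f ^ j) x‖) k
      have h5 : ‖(f ^ 0) x‖ = ‖x‖ := by simp
      rw [h2]
      simp only [hp]
      linarith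
    have h2 := hf x
    have h3 : γ * p x ≤ 1 / 2 * ‖x‖ := by
      have h4 : γ * p x ≤ γ * (C * ‖x‖) := mul_le_mul_of_nonneg_left (hpC x) hγ0.le
      have h5 : γ * C ≤ 1 / 2 := by
        rw [hγ, div_mul_eq_mul_div, div_le_iff₀ (by positivity)]
        linarith
      have h6 := mul_le_mul_of_nonneg_right h5 (norm_nonneg x)
      nlinarith
    linarith
  have hpd : Tendsto (fun n => p (d n)) atTop (𝓝 0) := by
    refine squeeze_zero (fun n => hp0 _) (fun n => hpC _) ?_
    simpa using hd.norm.const_mul C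
  have hsmall : ∀ c : ℝ, ∀ᶠ n in atTop, c * r n ≤ 1 := by
    intro c
    have h1 : Tendsto (fun n => c * r n) atTop (𝓝 0) := by simpa using hr_zero.const_mul c
    exact (h1.eventually (gt_mem_nhds one_pos)).mono fun n hn => hn.le
  have hpy : Tendsto (fun n => p (y n)) atTop (𝓝 0) := by
    refine tendsto_zero_of_le_contraction (c := 2 * γ) (by positivity) (fun n => hp0 _) hr hr_sum
      hpd (hsmall _) ?_
    filter_upwards [hsmall 2] with n hn
    have h1 : y (n + 1) = (1 - 2 * r n) • y n + ((2 * r n) • f (y n) + r n • d n) := by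
      rw [hy n]; module
    rw [h1]
    refine (hadd _ _).trans ?_
    rw [hsmul _ _ (by linarith)]
    have h2 := hadd ((2 * r n) • f (y n)) (r n • d n)
    rw [hsmul _ _ (by linarith [hr n] : 0 ≤ 2 * r n), hsmul _ _ (hr n)] at h2
    have h3 := mul_le_mul_of_nonneg_left (hpf (y n)) (by linarith [hr n] : 0 ≤ 2 * r n)
    nlinarith
  exact squeeze_zero_norm (fun n => hle _) hpy

/-- A linear recursion relaxing towards a power-contracting map `f`, perturbed by vanishing
drifts and by the terms of a convergent series, tends to zero. -/
theorem tendsto_zero_of_recursion (f : E →L[ℝ] E) {k : ℕ} (hk : 0 < k)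
    (hf : ∀ x, ‖(f ^ k) x‖ ≤ 1 / 2 * ‖x‖) {r : ℕ → ℝ} (hr : ∀ n, 0 ≤ r n)
    (hr_sum : Tendsto (fun n => ∑ k ∈ Finset.range n, r k) atTop atTop)
    (hr_zero : Tendsto r atTop (𝓝 0)) {y d e : ℕ → E} (hd : Tendsto d atTop (𝓝 0))
    {s : E} (he : Tendsto (fun n => ∑ k ∈ Finset.range n, e k) atTop (𝓝 s))
    (hy : ∀ n, y (n + 1) = y n + r n • ((2 : ℝ) • (f (y n) - y n) + d n) + e n) :
    Tendsto y atTop (𝓝 0) := by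
  -- Minus the tail of the noise series. Subtracting it from `y` removes `e` exactly, at the price
  -- of the vanishing drift `2 (f t - t)`.
  set t : ℕ → E := fun n => ∑ k ∈ Finset.range n, e k - s with ht
  have ht0 : Tendsto t atTop (𝓝 0) := by simpa [ht] using he.sub_const s
  have hft : Tendsto (fun n => f (t n)) atTop (𝓝 0) := by
    simpa [Function.comp_def] using (f.continuous.tendsto 0).comp ht0
  have h := tendsto_zero_of_recursion_of_drift f hk hf hr hr_sum hr_zero (y := fun n => y n - t n)
    (d := fun n => d n + (2 : ℝ) • (f (t n) - t n))
    (by simpa using hd.add ((hft.sub ht0).const_smul (2 : ℝ))) (by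
      intro n
      have h1 : t (n + 1) = t n + e n := by
        simp only [ht, Finset.sum_range_succ]; abel
      simp only [h1, hy n, map_sub]
      module)
  simpa using h.add ht0

end Recursion

/-! ### Matrices with a spectral gap -/

section Spectral

variable {ι : Type*} [Fintype ι] [DecidableEq ι]

/-- A real matrix whose complex eigenvalues lie in the open unit disc is power-contracting. -/
theorem exists_pow_mulVec_norm_le [Nonempty ι] (B : Matrix ι ι ℝ)
    (hB : ∀ (z : ℂ) (x : ι → ℂ), x ≠ 0 → B.map Complex.ofReal *ᵥ x = z • x → ‖z‖ < 1) :
    ∃ k, 0 < k ∧ ∀ x, ‖(B ^ k) *ᵥ x‖ ≤ 1 / 2 * ‖x‖ := by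
  let _ : NormedRing (Matrix ι ι ℂ) := Matrix.linftyOpNormedRing
  let _ : NormedAlgebra ℂ (Matrix ι ι ℂ) := Matrix.linftyOpNormedAlgebra
  set M : Matrix ι ι ℂ := B.map Complex.ofReal with hM
  -- Gelfand's formula turns a spectral radius below one into geometric decay of `‖M ^ k‖`. The
  -- operator norm is the one subordinate to the sup norm, which agrees on real and complexified
  -- vectors.
  have hrad : spectralRadius ℂ M < 1 := by
    refine spectrum.spectralRadius_lt_of_forall_lt (r := 1) M fun z hz => ?_
    have h1 : (algebraMap ℂ (Matrix ι ι ℂ) z - M).det = 0 := by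
      by_contra h
      exact hz ((Matrix.isUnit_iff_isUnit_det _).2 (isUnit_iff_ne_zero.2 h))
    obtain ⟨x, hx, hx0⟩ := Matrix.exists_mulVec_eq_zero_iff.2 h1
    have h2 : M *ᵥ x = z • x := by
      rw [Matrix.sub_mulVec, sub_eq_zero] at hx0
      rw [← hx0, Algebra.algebraMap_eq_smul_one, Matrix.smul_mulVec, Matrix.one_mulVec]
    exact_mod_cast hB z x hx h2
  obtain ⟨q, hq1, hq2⟩ := ENNReal.lt_iff_exists_nnreal_btwn.1 hrad
  have hq : q < 1 := by exact_mod_cast hq2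
  have hev := (spectrum.pow_nnnorm_pow_one_div_tendsto_nhds_spectralRadius M).eventually
    (gt_mem_nhds hq1)
  have hq0 : ∀ᶠ n : ℕ in atTop, q ^ n < 1 / 2 :=
    (tendsto_pow_atTop_nhds_zero_of_lt_one zero_le hq).eventually
      (gt_mem_nhds (by positivity))
  obtain ⟨k, hk1, hk2, hk3⟩ := (hev.and (hq0.and (eventually_gt_atTop 0))).exists
  refine ⟨k, hk3, fun x => ?_⟩
  have hnorm : ‖M ^ k‖₊ ≤ q ^ k := by
    have h1 : ((‖M ^ k‖₊ : ENNReal) ^ (1 / k : ℝ)) ^ (k : ℝ) ≤ (q : ENNReal) ^ (k : ℝ) :=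
      ENNReal.rpow_le_rpow hk1.le (by positivity)
    rw [← ENNReal.rpow_mul, one_div, inv_mul_cancel₀ (by positivity), ENNReal.rpow_one,
      ENNReal.rpow_natCast] at h1
    exact_mod_cast h1
  have hmap : (fun i => (((B ^ k) *ᵥ x) i : ℂ)) = (M ^ k) *ᵥ fun i => (x i : ℂ) := by
    have h1 : M ^ k = (B ^ k).map Complex.ofReal := by
      have := (Complex.ofRealHom.mapMatrix (m := ι)).map_pow B k
      exact this.symm
    rw [h1]
    ext i
    exact RingHom.map_mulVec Complex.ofRealHom (B ^ k) x i
  have hpi : ∀ v : ι → ℝ, ‖fun i => (v i : ℂ)‖ = ‖v‖ := by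
    intro v
    simp [Pi.norm_def]
  rw [← hpi, hmap, ← hpi x]
  refine (Matrix.linfty_opNorm_mulVec _ _).trans ?_
  gcongr
  have h3 : (‖M ^ k‖₊ : ℝ) ≤ ((1 / 2 : NNReal) : ℝ) := by exact_mod_cast hnorm.trans hk2.le
  simpa using h3

/-- The lazy version of a matrix with absolute row sums at most one, deflated by a projection
killing its fixed vectors, is power-contracting. -/
theorem exists_pow_lazy_mulVec_norm_le [Nonempty ι] {S Q : Matrix ι ι ℝ}
    (hS : ∀ i, ∑ j, |S i j| ≤ 1) (hQS : Q * S = Q) (hQQ : Q * Q = Q)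
    (hfix : ∀ x, S *ᵥ x = x → Q *ᵥ x = 0 → x = 0) :
    ∃ k, 0 < k ∧ ∀ x, ‖(((1 / 2 : ℝ) • (1 + S) - Q) ^ k) *ᵥ x‖ ≤ 1 / 2 * ‖x‖ := by
  refine exists_pow_mulVec_norm_le _ fun z x hx hzx => ?_
  by_contra hz
  push Not at hz
  have hz0 : z ≠ 0 := by
    rintro rfl
    simp at hz
    linarith
  set T : Matrix ι ι ℂ := S.map Complex.ofReal with hT
  set R : Matrix ι ι ℂ := Q.map Complex.ofReal with hR
  have hmul : ∀ X Y : Matrix ι ι ℝ,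
      (X * Y).map Complex.ofReal = X.map Complex.ofReal * Y.map Complex.ofReal :=
    fun X Y => Matrix.map_mul (f := Complex.ofRealHom)
  have hRT : R * T = R := by rw [hR, hT, ← hmul, hQS]
  have hRR : R * R = R := by rw [hR, ← hmul, hQQ]
  have hB : ((1 / 2 : ℝ) • (1 + S) - Q).map Complex.ofReal = (1 / 2 : ℂ) • (1 + T) - R := by
    ext i j
    by_cases hij : i = j
    · subst hij; simp [hT, hR]
    · simp [hT, hR, hij]
  rw [hB] at hzx
  -- So an eigenvector for a nonzero eigenvalue is killed by the projection, and is therefore an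
  -- eigenvector of `T` itself.
  have hRB : R * ((1 / 2 : ℂ) • (1 + T) - R) = 0 := by
    rw [mul_sub, Matrix.mul_smul, mul_add, mul_one, hRT, hRR]
    ext i j
    simp
    ring
  have hRx : R *ᵥ x = 0 := by
    have h1 : R *ᵥ (z • x) = 0 := by
      rw [← hzx, Matrix.mulVec_mulVec, hRB, Matrix.zero_mulVec]
    rw [Matrix.mulVec_smul] at h1
    exact (smul_eq_zero.1 h1).resolve_left hz0
  have hTx : T *ᵥ x = (2 * z - 1) • x := by
    rw [Matrix.sub_mulVec, hRx, sub_zero, Matrix.smul_mulVec, Matrix.add_mulVec,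
      Matrix.one_mulVec] at hzx
    have h1 : x + T *ᵥ x = (2 * z) • x := by
      rw [mul_smul, ← hzx, smul_smul]; norm_num
    rw [sub_smul, ← h1, one_smul, add_sub_cancel_left]
  have hle : ‖2 * z - 1‖ ≤ 1 := by
    have h1 : ‖T *ᵥ x‖ ≤ ‖x‖ := by
      refine (pi_norm_le_iff_of_nonneg (norm_nonneg _)).2 fun i => ?_
      calc ‖∑ j, T i j * x j‖ ≤ ∑ j, ‖T i j * x j‖ := norm_sum_le _ _
        _ ≤ ∑ j, |S i j| * ‖x‖ := by
            refine Finset.sum_le_sum fun j _ => ?_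
            rw [norm_mul, hT, Matrix.map_apply, Complex.norm_real, Real.norm_eq_abs]
            exact mul_le_mul_of_nonneg_left (norm_le_pi_norm x j) (abs_nonneg _)
        _ ≤ ‖x‖ := by
            rw [← Finset.sum_mul]
            exact mul_le_of_le_one_left (norm_nonneg _) (hS i)
    rw [hTx, norm_smul] at h1
    have h2 : 0 < ‖x‖ := norm_pos_iff.2 hx
    exact le_of_mul_le_mul_right (by linarith) h2
  -- The disc `‖2 * z - 1‖ ≤ 1` touches `1 ≤ ‖z‖` only at 1. This is the point of laziness: the
  -- other unimodular eigenvalues of `S`, due to periodicity, do no harm.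
  have hz1 : z = 1 := by
    have h1 : Complex.normSq (2 * z - 1) ≤ 1 := by
      rw [Complex.normSq_eq_norm_sq]; nlinarith [norm_nonneg (2 * z - 1)]
    have h2 : 1 ≤ Complex.normSq z := by
      rw [Complex.normSq_eq_norm_sq]; nlinarith
    rw [Complex.normSq_apply] at h1 h2
    simp at h1
    have h3 : 1 ≤ z.re := by nlinarith
    have h4 : z.re ≤ 1 := by nlinarith
    have h5 : z.im = 0 := by nlinarith [sq_nonneg z.im]
    exact Complex.ext (by simp; linarith) (by simpa using h5)
  rw [hz1] at hTx
  norm_num at hTx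
  have hre : ∀ (X : Matrix ι ι ℝ) i,
      ((X.map Complex.ofReal *ᵥ x) i).re = (X *ᵥ fun j => (x j).re) i := by
    intro X i
    simp [Matrix.mulVec, dotProduct]
  have him : ∀ (X : Matrix ι ι ℝ) i,
      ((X.map Complex.ofReal *ᵥ x) i).im = (X *ᵥ fun j => (x j).im) i := by
    intro X i
    simp [Matrix.mulVec, dotProduct]
  have h1 := hfix (fun j => (x j).re) (funext fun i => by rw [← hre, ← hT, hTx])
    (funext fun i => by rw [← hre, ← hR, hRx]; rfl)
  have h2 := hfix (fun j => (x j).im) (funext fun i => by rw [← him, ← hT, hTx])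
    (funext fun i => by rw [← him, ← hR, hRx]; rfl)
  exact hx (funext fun i => Complex.ext (congrFun h1 i) (congrFun h2 i))

end Spectral

/-! ### Affine recursions driven by a matrix -/

section AffineRecursion

variable {ι : Type*} [Fintype ι] [DecidableEq ι]

theorem mulVecLin_toContinuousLinearMap_pow_apply (B : Matrix ι ι ℝ) (k : ℕ) (x : ι → ℝ) :
    ((B.mulVecLin.toContinuousLinearMap) ^ k) x = (B ^ k) *ᵥ x := by
  induction k generalizing x with
  | zero => simp
  | succ k ih =>
    rw [pow_succ, pow_succ, ← Matrix.mulVec_mulVec, ← ih]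
    rfl

/-- If `S` has absolute row sums at most one and `S - 1` is invertible, a stochastic approximation
with drift `(S - 1) x + b n`, where `b n → b`, tends to the zero of the limit drift. -/
theorem tendsto_of_affine_recursion {S : Matrix ι ι ℝ} (hS : ∀ i, ∑ j, |S i j| ≤ 1)
    (hinv : IsUnit (S - 1)) {r : ℕ → ℝ} (hr : ∀ n, 0 ≤ r n)
    (hr_sum : Tendsto (fun n => ∑ k ∈ Finset.range n, r k) atTop atTop)
    (hr_zero : Tendsto r atTop (𝓝 0)) {x b e : ℕ → ι → ℝ} {b' s : ι → ℝ}
    (hb : Tendsto b atTop (𝓝 b'))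
    (he : Tendsto (fun n => ∑ k ∈ Finset.range n, e k) atTop (𝓝 s))
    (hx : ∀ n, x (n + 1) = x n + r n • ((S - 1) *ᵥ x n + b n) + e n) :
    Tendsto x atTop (𝓝 (-((S - 1)⁻¹ *ᵥ b'))) := by
  cases isEmpty_or_nonempty ι
  · exact tendsto_const_nhds.congr fun n => Subsingleton.elim _ _
  have hdet : IsUnit (S - 1).det := (Matrix.isUnit_iff_isUnit_det _).1 hinv
  obtain ⟨k, hk, hkx⟩ := exists_pow_lazy_mulVec_norm_le (Q := 0) hS (by simp) (by simp)
    (fun v hv _ => by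
      have h1 : (S - 1) *ᵥ v = 0 := by rw [Matrix.sub_mulVec, Matrix.one_mulVec, hv, sub_self]
      calc v = ((S - 1)⁻¹ * (S - 1)) *ᵥ v := by
              rw [Matrix.nonsing_inv_mul _ hdet, Matrix.one_mulVec]
        _ = 0 := by rw [← Matrix.mulVec_mulVec, h1, Matrix.mulVec_zero])
  -- Here `S - 1 = 2 (B - 1)`, whence the factor 2 in the abstract recursion. No fixed direction has
  -- to be deflated.
  set B : Matrix ι ι ℝ := (1 / 2 : ℝ) • (1 + S) - 0 with hB
  set l : ι → ℝ := -((S - 1)⁻¹ *ᵥ b') with hl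
  have hSl : (S - 1) *ᵥ l = -b' := by
    rw [hl, Matrix.mulVec_neg, Matrix.mulVec_mulVec, Matrix.mul_nonsing_inv _ hdet,
      Matrix.one_mulVec]
  have h := tendsto_zero_of_recursion B.mulVecLin.toContinuousLinearMap hk
    (fun v => by rw [mulVecLin_toContinuousLinearMap_pow_apply]; exact hkx v) hr hr_sum hr_zero
    (y := fun n => x n - l) (d := fun n => b n - b') (e := e)
    (by simpa using hb.sub_const b') he (by
      intro n
      have h1 : (2 : ℝ) • (B *ᵥ (x n - l) - (x n - l)) = (S - 1) *ᵥ x n + b' := by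
        have h2 : B *ᵥ (x n - l) - (x n - l) = (1 / 2 : ℝ) • ((S - 1) *ᵥ (x n - l)) := by
          rw [hB, sub_zero, Matrix.smul_mulVec, Matrix.add_mulVec, Matrix.sub_mulVec,
            Matrix.one_mulVec]
          module
        rw [h2, Matrix.mulVec_sub, hSl]
        module
      change x (n + 1) - l = x n - l + r n • ((2 : ℝ) • (B *ᵥ (x n - l) - (x n - l)) + _) + e n
      rw [h1, hx n]
      module)
  simpa using h.add_const l

/-- If `S` is a row-stochastic matrix with invariant distribution `v` whose only harmonic
vectors are the constants, a stochastic approximation with drift `(S - 1) x` tends to a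
consensus. -/
theorem tendsto_consensus_of_recursion {S : Matrix ι ι ℝ} (hS : S ∈ Matrix.rowStochastic ℝ ι)
    {v : ι → ℝ} (hv : v ᵥ* S = v) (hv_sum : ∑ i, v i = 1)
    (hharm : ∀ x, S *ᵥ x = x → ∀ i j, x i = x j) {r : ℕ → ℝ} (hr : ∀ n, 0 ≤ r n)
    (hr_sum : Tendsto (fun n => ∑ k ∈ Finset.range n, r k) atTop atTop)
    (hr_zero : Tendsto r atTop (𝓝 0)) {x e : ℕ → ι → ℝ} {s : ι → ℝ}
    (he : Tendsto (fun n => ∑ k ∈ Finset.range n, e k) atTop (𝓝 s))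
    (hx : ∀ n, x (n + 1) = x n + r n • ((S - 1) *ᵥ x n) + e n) :
    ∃ c : ℝ, ∀ i, Tendsto (fun n => x n i) atTop (𝓝 c) := by
  cases isEmpty_or_nonempty ι
  · exact ⟨0, fun i => isEmptyElim i⟩
  -- Projection onto the constants along the kernel of `v`. Since `Q * (S - 1) = 0`, the part `Q x`
  -- moves by noise only; the part `x - Q x` feels the deflated lazy matrix, which is
  -- power-contracting.
  set Q : Matrix ι ι ℝ := Matrix.of fun _ j => v j with hQ
  have hQx : ∀ y, Q *ᵥ y = fun _ => v ⬝ᵥ y := fun y => rfl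
  have hQS : Q * S = Q := by
    ext i j
    exact congrFun hv j
  have hQQ : Q * Q = Q := by
    ext i j
    simp [hQ, Matrix.mul_apply, ← Finset.sum_mul, hv_sum]
  have habs : ∀ i, ∑ j, |S i j| ≤ 1 := by
    intro i
    rw [← Matrix.sum_row_of_mem_rowStochastic hS i]
    exact (Finset.sum_congr rfl fun j _ =>
      abs_of_nonneg (Matrix.nonneg_of_mem_rowStochastic hS)).le
  obtain ⟨k, hk, hkx⟩ := exists_pow_lazy_mulVec_norm_le habs hQS hQQ (fun y hy hy0 => by
    have h1 := hharm y hy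
    ext i
    have h2 : v ⬝ᵥ y = 0 := by simpa [hQx] using congrFun hy0 i
    have h3 : v ⬝ᵥ y = y i := by
      simp only [dotProduct]
      rw [Finset.sum_congr rfl fun j _ => by rw [h1 j i], ← Finset.sum_mul, hv_sum, one_mul]
    simpa [h3] using h2)
  set B : Matrix ι ι ℝ := (1 / 2 : ℝ) • (1 + S) - Q with hB
  have hSQ : ∀ y, (S - 1) *ᵥ (Q *ᵥ y) = 0 := by
    intro y
    rw [hQx, Matrix.sub_mulVec, Matrix.one_mulVec]
    ext i
    have h1 := Matrix.sum_row_of_mem_rowStochastic hS i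
    simp [Matrix.mulVec, dotProduct, ← Finset.sum_mul, h1]
  have hQS1 : ∀ y, Q *ᵥ ((S - 1) *ᵥ y) = 0 := by
    intro y
    rw [Matrix.mulVec_mulVec, mul_sub, hQS, mul_one, sub_self, Matrix.zero_mulVec]
  have hQsum : Tendsto (fun n => ∑ k ∈ Finset.range n, Q *ᵥ e k) atTop (𝓝 (Q *ᵥ s)) := by
    have h1 := (Q.mulVecLin.continuous_of_finiteDimensional.tendsto s).comp he
    refine h1.congr fun n => ?_
    simp only [Function.comp, map_sum]
    rfl
  have hy := tendsto_zero_of_recursion B.mulVecLin.toContinuousLinearMap hk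
    (fun v => by rw [mulVecLin_toContinuousLinearMap_pow_apply]; exact hkx v) hr hr_sum hr_zero
    (y := fun n => x n - Q *ᵥ x n) (d := fun _ => 0) (e := fun n => e n - Q *ᵥ e n)
    (s := s - Q *ᵥ s) tendsto_const_nhds
    ((he.sub hQsum).congr fun n => (Finset.sum_sub_distrib _ _).symm) (by
      intro n
      have h0 : Q *ᵥ (x n - Q *ᵥ x n) = 0 := by
        rw [Matrix.mulVec_sub, Matrix.mulVec_mulVec, hQQ, sub_self]
      have h1 : (2 : ℝ) • (B *ᵥ (x n - Q *ᵥ x n) - (x n - Q *ᵥ x n)) = (S - 1) *ᵥ x n := by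
        have h2 : B *ᵥ (x n - Q *ᵥ x n) - (x n - Q *ᵥ x n)
            = (1 / 2 : ℝ) • ((S - 1) *ᵥ (x n - Q *ᵥ x n)) := by
          rw [hB, Matrix.sub_mulVec, h0, Matrix.smul_mulVec, Matrix.add_mulVec,
            Matrix.sub_mulVec S, Matrix.one_mulVec]
          module
        rw [h2, Matrix.mulVec_sub, hSQ]
        module
      change x (n + 1) - Q *ᵥ x (n + 1) = x n - Q *ᵥ x n +
        r n • ((2 : ℝ) • (B *ᵥ (x n - Q *ᵥ x n) - (x n - Q *ᵥ x n)) + 0) + (e n - Q *ᵥ e n)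
      rw [h1, hx n, Matrix.mulVec_add, Matrix.mulVec_add, Matrix.mulVec_smul, hQS1]
      module)
  have hQxn : ∀ n, Q *ᵥ x n = Q *ᵥ x 0 + ∑ k ∈ Finset.range n, Q *ᵥ e k := by
    intro n
    induction n with
    | zero => simp
    | succ n ih =>
      rw [hx n, Matrix.mulVec_add, Matrix.mulVec_add, Matrix.mulVec_smul, hQS1, ih,
        Finset.sum_range_succ]
      module
  have hlim : Tendsto x atTop (𝓝 (Q *ᵥ x 0 + Q *ᵥ s)) := by
    have h1 : Tendsto (fun n => Q *ᵥ x n) atTop (𝓝 (Q *ᵥ x 0 + Q *ᵥ s)) :=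
      (hQsum.const_add _).congr fun n => (hQxn n).symm
    simpa using hy.add h1
  exact ⟨v ⬝ᵥ x 0 + v ⬝ᵥ s, fun i => by simpa [hQx] using (tendsto_pi_nhds.1 hlim) i⟩

end AffineRecursion

end ReinforcedNetwork

namespace ReinforcedNetwork

/-! ### The hierarchical representation -/

section Hierarchy

variable {V : Type*} {A : Matrix V V ℝ}

theorem isLevelClass_zero {T : Finset V} :
    IsLevelClass A 0 T ↔ IsCommunicatingClass A T ∧ ∀ i ∈ T, ∀ j, j ∉ T → A i j = 0 := by
  rw [IsLevelClass]

theorem isLevelClass_succ {m : ℕ} {T : Finset V} :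
    IsLevelClass A (m + 1) T ↔ IsCommunicatingClass A T ∧
      (∀ i ∈ T, ∀ j, j ∉ T →
        (∀ s, ∀ _ : s ≤ m, ∀ S, IsLevelClass A s S → j ∉ S) → A i j = 0) ∧
      ∃ i ∈ T, ∃ j, j ∉ T ∧ (∃ S, IsLevelClass A m S ∧ j ∈ S) ∧ 0 < A i j := by
  rw [IsLevelClass]

theorem IsLevelClass.isCommunicatingClass {m : ℕ} {T : Finset V} (h : IsLevelClass A m T) :
    IsCommunicatingClass A T := by
  cases m with
  | zero => exact (isLevelClass_zero.1 h).1
  | succ m => exact (isLevelClass_succ.1 h).1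

/-- Every edge leaving a class of level `m` leads to a class of lower level. -/
theorem IsLevelClass.exists_of_ne_zero {m : ℕ} {T : Finset V} (h : IsLevelClass A m T) {i j : V}
    (hi : i ∈ T) (hj : j ∉ T) (hij : A i j ≠ 0) :
    ∃ t < m, ∃ S, IsLevelClass A t S ∧ j ∈ S := by
  cases m with
  | zero => exact absurd ((isLevelClass_zero.1 h).2 i hi j hj) hij
  | succ m =>
    by_contra! hno
    exact hij ((isLevelClass_succ.1 h).2.1 i hi j hj fun s hs S hS => hno s (by lia) S hS)

theorem IsCommunicatingClass.eq_of_mem {S T : Finset V} (hS : IsCommunicatingClass A S)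
    (hT : IsCommunicatingClass A T) {i : V} (hiS : i ∈ S) (hiT : i ∈ T) : S = T := by
  ext j
  rw [hS.2 i hiS, hT.2 i hiT]

/-- A property that propagates along the edges inside a communicating class holds on the whole
class as soon as it holds at one of its agents. -/
theorem IsCommunicatingClass.forall_of_propagates {T : Finset V} (hT : IsCommunicatingClass A T)
    {p : V → Prop} (hp : ∀ i ∈ T, ∀ j ∈ T, i ≠ j → A i j ≠ 0 → p i → p j) {i : V} (hi : i ∈ T)
    (hpi : p i) : ∀ j ∈ T, p j := by
  intro j hj
  have hji := ((hT.2 i hi j).1 hj).2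
  -- A path from `i` to `j` never leaves the class: each of its vertices reaches `j`, hence `i`.
  have key : ∀ k, Relation.ReflTransGen (interactionGraph A).Adj i k →
      Relation.ReflTransGen (interactionGraph A).Adj k j → k ∈ T ∧ p k := by
    intro k hik
    induction hik with
    | refl => exact fun _ => ⟨hi, hpi⟩
    | tail hab hbc ih =>
      intro hcj
      obtain ⟨hb, hpb⟩ := ih (hcj.head hbc)
      have hc := (hT.2 i hi _).2 ⟨hab.tail hbc, hcj.trans hji⟩
      exact ⟨hc, hp _ hb _ hc hbc.1 hbc.2 hpb⟩
  exact (key j ((hT.2 i hi j).1 hj).1 .refl).2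

/-- An agent belongs to at most one class of the hierarchical representation. -/
theorem IsLevelClass.unique {m t : ℕ} {S T : Finset V} (hT : IsLevelClass A m T)
    (hS : IsLevelClass A t S) {i : V} (hiT : i ∈ T) (hiS : i ∈ S) : m = t ∧ T = S := by
  have hTS : T = S := hT.isCommunicatingClass.eq_of_mem hS.isCommunicatingClass hiT hiS
  refine ⟨?_, hTS⟩
  -- The edge witnessing level `m' + 1` ends in a class of level `m'`. Read from level `t`, its
  -- endpoint lies in a class of level `u < t`; induction gives `m' ≤ u`.
  have key : ∀ m t : ℕ, ∀ T, IsLevelClass A m T → IsLevelClass A t T → m ≤ t := by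
    intro m
    induction m using Nat.strong_induction_on with
    | _ m ih =>
      intro t T hm ht
      by_contra! hlt
      obtain ⟨m, rfl⟩ : ∃ m', m = m' + 1 := ⟨m - 1, by lia⟩
      obtain ⟨-, -, i, hi, j, hj, ⟨S, hS, hjS⟩, hij⟩ := isLevelClass_succ.1 hm
      obtain ⟨u, hu, U, hU, hjU⟩ := ht.exists_of_ne_zero hi hj hij.ne'
      have hSU := hS.isCommunicatingClass.eq_of_mem hU.isCommunicatingClass hjS hjU
      have := ih m (by lia) u S hS (hSU ▸ hU)
      lia
  subst hTS
  exact le_antisymm (key _ _ _ hT hS) (key _ _ _ hS hT)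

/-- Every agent belongs to a class of the hierarchical representation. -/
theorem exists_isLevelClass [Fintype V] (hA : ∀ i j, 0 ≤ A i j) (i : V) :
    ∃ m T, IsLevelClass A m T ∧ i ∈ T := by
  classical
  let reach : V → Finset V := fun i =>
    Finset.univ.filter fun j => Relation.ReflTransGen (interactionGraph A).Adj i j
  have hreach : ∀ i j, j ∈ reach i ↔ Relation.ReflTransGen (interactionGraph A).Adj i j := by
    simp [reach]
  -- A vertex entered by an edge leaving the class of `i` cannot reach `i`, so it reaches strictly
  -- fewer vertices. The level is one more than the maximal level of these exits, or 0 if there are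
  -- none.
  induction hn : (reach i).card using Nat.strong_induction_on generalizing i with
  | _ n ih =>
    set T : Finset V := Finset.univ.filter (Communicate A i) with hT
    have hmem : ∀ j, j ∈ T ↔ Communicate A i j := by simp [hT]
    have hiT : i ∈ T := (hmem i).2 ⟨.refl, .refl⟩
    have hcls : IsCommunicatingClass A T := by
      refine ⟨⟨i, hiT⟩, fun j hj k => ?_⟩
      rw [hmem] at hj ⊢
      exact ⟨fun hk => ⟨hj.2.trans hk.1, hk.2.trans hj.1⟩,
        fun hk => ⟨hj.1.trans hk.1, hk.2.trans hj.2⟩⟩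
    set N : Finset V := Finset.univ.filter fun j => j ∉ T ∧ ∃ i' ∈ T, A i' j ≠ 0 with hN
    have hNmem : ∀ j, j ∈ N ↔ j ∉ T ∧ ∃ i' ∈ T, A i' j ≠ 0 := by simp [hN]
    have hlow : ∀ j ∈ N, ∃ m S, IsLevelClass A m S ∧ j ∈ S := by
      intro j hj
      obtain ⟨hjT, i', hi', hij⟩ := (hNmem j).1 hj
      have hi'j : Relation.ReflTransGen (interactionGraph A).Adj i j :=
        ((hmem i').1 hi').1.tail ⟨fun h => hjT (h ▸ hi'), hij⟩
      refine ih (reach j).card ?_ j rfl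
      rw [← hn]
      refine Finset.card_lt_card (Finset.ssubset_iff_of_subset ?_ |>.2 ⟨i, ?_, ?_⟩)
      · intro k hk
        rw [hreach] at hk ⊢
        exact hi'j.trans hk
      · rw [hreach]
      · rw [hreach]
        exact fun hji => hjT ((hmem j).2 ⟨hi'j, hji⟩)
    rcases N.eq_empty_or_nonempty with hemp | hne
    · refine ⟨0, T, isLevelClass_zero.2 ⟨hcls, fun i' hi' j hj => ?_⟩, hiT⟩
      by_contra hij
      have : j ∈ N := (hNmem j).2 ⟨hj, i', hi', hij⟩
      simp [hemp] at this
    · choose! lev cls hlev hcl using hlow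
      obtain ⟨j, hjN, hmax⟩ := Finset.exists_max_image N lev hne
      refine ⟨lev j + 1, T, isLevelClass_succ.2 ⟨hcls, ?_, ?_⟩, hiT⟩
      · intro i' hi' k hk hnot
        by_contra hik
        have hkN : k ∈ N := (hNmem k).2 ⟨hk, i', hi', hik⟩
        exact hnot (lev k) (hmax k hkN) _ (hlev k hkN) (hcl k hkN)
      · obtain ⟨hjT, i', hi', hij⟩ := (hNmem j).1 hjN
        exact ⟨i', hi', j, hjT, ⟨_, hlev j hjN, hcl j hjN⟩, (hA i' j).lt_of_ne' hij⟩

/-- Every agent belongs to exactly one class of the hierarchical representation. -/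
theorem existsUnique_isLevelClass [Fintype V] (hA : ∀ i j, 0 ≤ A i j) (i : V) :
    ∃! p : ℕ × Finset V, IsLevelClass A p.1 p.2 ∧ i ∈ p.2 := by
  obtain ⟨m, T, hT, hi⟩ := exists_isLevelClass hA i
  refine ⟨(m, T), ⟨hT, hi⟩, fun p hp => ?_⟩
  obtain ⟨h1, h2⟩ := hp.1.unique hT hp.2 hi
  exact Prod.ext h1 h2

theorem mem_levelClasses [Fintype V] {m : ℕ} {T : Finset V} :
    T ∈ levelClasses A m ↔ IsLevelClass A m T := by
  simp [levelClasses]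

/-- The row of an agent of a class of level `m` is carried by the class and by the classes of
lower level. -/
theorem IsLevelClass.sum_row [Fintype V] [DecidableEq V] {m : ℕ} {T : Finset V}
    (hT : IsLevelClass A m T) {i : V} (hi : i ∈ T) (f : V → ℝ) :
    ∑ j, A i j * f j = ∑ j ∈ T, A i j * f j +
      ∑ t ∈ Finset.range m, ∑ S ∈ levelClasses A t, ∑ j ∈ S, A i j * f j := by
  rw [← Finset.sum_add_sum_compl T]
  congr 1
  have hind : ∀ S : Finset V, ∑ j ∈ S, A i j * f j = ∑ j, if j ∈ S then A i j * f j else 0 := by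
    intro S
    rw [Finset.sum_ite_mem, Finset.univ_inter]
  simp_rw [hind]
  rw [Finset.sum_congr rfl fun t _ => Finset.sum_comm, Finset.sum_comm]
  refine Finset.sum_congr rfl fun j _ => ?_
  by_cases hj : j ∈ T
  · rw [if_neg (by simpa using hj)]
    refine (Finset.sum_eq_zero fun t ht => Finset.sum_eq_zero fun S hS => if_neg fun hjS => ?_).symm
    have := (hT.unique (mem_levelClasses.1 hS) hj hjS).1
    have := Finset.mem_range.1 ht
    lia
  · rw [if_pos (by simpa using hj)]
    by_cases hij : A i j = 0
    · simp [hij]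
    obtain ⟨t, ht, S, hS, hjS⟩ := hT.exists_of_ne_zero hi hj hij
    rw [Finset.sum_eq_single_of_mem t (Finset.mem_range.2 ht), Finset.sum_eq_single_of_mem S
      (mem_levelClasses.2 hS), if_pos hjS]
    · intro U hU hUS
      exact if_neg fun hjU => hUS ((mem_levelClasses.1 hU).unique hS hjU hjS).2
    · intro u _ hut
      exact Finset.sum_eq_zero fun U hU =>
        if_neg fun hjU => hut ((mem_levelClasses.1 hU).unique hS hjU hjS).1

end Hierarchy

end ReinforcedNetwork

namespace ReinforcedNetwork

/-! ### The blocks of a class -/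

section DriftMatrix

variable {V : Type*} [DecidableEq V] {A : Matrix V V ℝ}

/-- Competition flips the off-diagonal entries and keeps the diagonal. One maximum principle and one
row-sum bound therefore serve both attitudes. -/
theorem abs_driftMatrix_add_one (hA : ∀ i j, 0 ≤ A i j) (T : Finset V) (a : Attitude)
    (i j : T) : |(driftMatrix A T a + 1) i j| = A i j := by
  cases a with
  | cooperative => simp [driftMatrix, block, abs_of_nonneg (hA i j)]
  | competitive =>
    by_cases hij : i = j
    · subst hij
      simp only [driftMatrix, block, Matrix.add_apply, Matrix.sub_apply, Matrix.smul_apply,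
        Matrix.diagonal_apply_eq, Matrix.one_apply_eq, Matrix.submatrix_apply, Matrix.diag_apply,
        smul_eq_mul]
      rw [← abs_of_nonneg (hA i i)]
      congr 1
      rw [abs_of_nonneg (hA i i)]
      ring
    · simp [driftMatrix, block, hij, abs_of_nonneg (hA i j)]

theorem driftMatrix_competitive_add_one_apply (T : Finset V) {i j : T} (hij : i ≠ j) :
    (driftMatrix A T .competitive + 1) i j = -A i j := by
  simp [driftMatrix, block, hij]

theorem isUnit_driftMatrix_of_fixed {T : Finset V} {a : Attitude}
    (h : ∀ x, (driftMatrix A T a + 1) *ᵥ x = x → x = 0) : IsUnit (driftMatrix A T a) := by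
  rw [Matrix.isUnit_iff_isUnit_det, isUnit_iff_ne_zero]
  intro hdet
  obtain ⟨x, hx, hx0⟩ := Matrix.exists_mulVec_eq_zero_iff.2 hdet
  exact hx (h x (by rw [Matrix.add_mulVec, hx0, Matrix.one_mulVec, zero_add]))

end DriftMatrix

/-! ### Maximum principle, invertibility and invariant distributions -/

section ClassBlocks

variable {V : Type*} [Fintype V] [DecidableEq V] {A : Matrix V V ℝ}

theorem sum_class_le_one (hA : A ∈ Matrix.rowStochastic ℝ V) (T : Finset V) (i : V) :
    ∑ j ∈ T, A i j ≤ 1 := by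
  rw [← Matrix.sum_row_of_mem_rowStochastic hA i]
  exact Finset.sum_le_univ_sum_of_nonneg fun j => Matrix.nonneg_of_mem_rowStochastic hA

theorem eq_zero_of_sum_class_eq_one (hA : A ∈ Matrix.rowStochastic ℝ V) {T : Finset V} {i j : V}
    (h : ∑ j ∈ T, A i j = 1) (hj : j ∉ T) : A i j = 0 := by
  have h1 := Matrix.sum_row_of_mem_rowStochastic hA i
  rw [← Finset.sum_add_sum_compl T, h] at h1
  exact (Finset.sum_eq_zero_iff_of_nonneg fun j _ => Matrix.nonneg_of_mem_rowStochastic hA).1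
    (show ∑ j ∈ Tᶜ, A i j = 0 by linarith) j (by simpa using hj)

/-- The maximum principle for fixed vectors of a signed version `M` of a diagonal block of a
row-stochastic matrix. -/
theorem IsCommunicatingClass.maximum_principle (hA : A ∈ Matrix.rowStochastic ℝ V) {T : Finset V}
    (hT : IsCommunicatingClass A T) {M : Matrix T T ℝ} (hM : ∀ i j, |M i j| = A i j)
    {x : T → ℝ} (hx : M *ᵥ x = x) :
    ∃ c, (∀ i, |x i| = c) ∧ (∀ i j, M i j * x j * x i = A i j * c ^ 2) ∧
      (c ≠ 0 → ∀ i ∈ T, ∀ j ∉ T, A i j = 0) := by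
  obtain ⟨i₀, hi₀⟩ := hT.1
  have : Nonempty T := ⟨⟨i₀, hi₀⟩⟩
  obtain ⟨i₁, hmax⟩ := Finite.exists_max fun i => |x i|
  set c := |x i₁| with hc
  have hc0 : 0 ≤ c := abs_nonneg _
  -- Multiplying the fixed-point equation by `x i` makes it insensitive to signs. At a maximiser of
  -- `|x|` these nonnegative defects sum to `-c ^ 2` times the mass leaving `T`, so both the defects
  -- and this product vanish.
  have hterm : ∀ i j : T, 0 ≤ A i j * c ^ 2 - M i j * x j * x i := by
    intro i j
    have h1 : |M i j * x j * x i| ≤ A i j * (c * c) := by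
      rw [mul_assoc, abs_mul, abs_mul, hM]
      exact mul_le_mul_of_nonneg_left
        (mul_le_mul (hmax j) (hmax i) (abs_nonneg _) hc0)
        (Matrix.nonneg_of_mem_rowStochastic hA)
    have h2 := le_abs_self (M i j * x j * x i)
    nlinarith
  have hsum : ∀ i : T, |x i| = c → ∑ j : T, (A i j * c ^ 2 - M i j * x j * x i)
      = -(c ^ 2 * (1 - ∑ j ∈ T, A i j)) := by
    intro i hi
    have h1 : ∑ j, M i j * x j = x i := congrFun hx i
    rw [Finset.sum_sub_distrib, ← Finset.sum_mul, ← Finset.sum_mul, h1, ← pow_two,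
      ← sq_abs (x i), hi, ← Finset.sum_coe_sort T]
    ring
  have hzero : ∀ i : T, |x i| = c → (∀ j : T, A i j * c ^ 2 - M i j * x j * x i = 0) ∧
      c ^ 2 * (1 - ∑ j ∈ T, A i j) = 0 := by
    intro i hi
    have h1 := hsum i hi
    have h2 : 0 ≤ c ^ 2 * (1 - ∑ j ∈ T, A i j) :=
      mul_nonneg (sq_nonneg _) (by linarith [sum_class_le_one hA T i])
    have h3 : 0 ≤ ∑ j : T, (A i j * c ^ 2 - M i j * x j * x i) :=
      Finset.sum_nonneg fun j _ => hterm i j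
    refine ⟨fun j => ?_, by linarith⟩
    exact (Finset.sum_eq_zero_iff_of_nonneg fun j _ => hterm i j).1
      (le_antisymm (by linarith) h3) j (Finset.mem_univ j)
  have hall : ∀ i ∈ T, ∀ h : i ∈ T, |x ⟨i, h⟩| = c := by
    refine hT.forall_of_propagates (p := fun i => ∀ h : i ∈ T, |x ⟨i, h⟩| = c) ?_ i₁.2
      (fun _ => rfl)
    intro i hi j hj _ hij hpi _
    rcases hc0.eq_or_lt with h0 | h0
    · exact le_antisymm (hmax ⟨j, hj⟩) (h0 ▸ abs_nonneg _)
    have h1 := (hzero ⟨i, hi⟩ (hpi hi)).1 ⟨j, hj⟩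
    -- A zero defect along an edge makes its endpoint a maximiser too.
    have h2 : A i j * c ^ 2 = |M ⟨i, hi⟩ ⟨j, hj⟩ * x ⟨j, hj⟩ * x ⟨i, hi⟩| := by
      rw [← sub_eq_zero.1 h1, abs_of_nonneg]
      exact mul_nonneg (Matrix.nonneg_of_mem_rowStochastic hA) (sq_nonneg _)
    rw [abs_mul, abs_mul, hM, hpi hi, mul_assoc] at h2
    have h3 := mul_left_cancel₀ hij h2
    rw [pow_two] at h3
    exact (mul_right_cancel₀ h0.ne' h3).symm
  refine ⟨c, fun i => hall i i.2 i.2, fun i j => ?_, fun hcne i hi j hj => ?_⟩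
  · linarith [(hzero i (hall i i.2 i.2)).1 j]
  · have h1 := (hzero ⟨i, hi⟩ (hall i hi hi)).2
    have h2 := (mul_eq_zero.1 h1).resolve_left (pow_ne_zero 2 hcne)
    exact eq_zero_of_sum_class_eq_one hA (by linarith) hj

theorem sum_abs_driftMatrix_add_one_le (hA : A ∈ Matrix.rowStochastic ℝ V) (T : Finset V)
    (a : Attitude) (i : T) : ∑ j, |(driftMatrix A T a + 1) i j| ≤ 1 := by
  simp_rw [abs_driftMatrix_add_one (fun _ _ => Matrix.nonneg_of_mem_rowStochastic hA)]
  rw [Finset.sum_coe_sort T fun j => A i j]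
  exact sum_class_le_one hA T i

/-- The drift matrix of a class of positive level is invertible. -/
theorem IsLevelClass.isUnit_driftMatrix (hA : A ∈ Matrix.rowStochastic ℝ V) {m : ℕ}
    (hm : 1 ≤ m) {T : Finset V} (hT : IsLevelClass A m T) (a : Attitude) :
    IsUnit (driftMatrix A T a) := by
  refine isUnit_driftMatrix_of_fixed fun x hx => ?_
  obtain ⟨c, hc, -, hout⟩ := hT.isCommunicatingClass.maximum_principle hA
    (abs_driftMatrix_add_one (fun _ _ => Matrix.nonneg_of_mem_rowStochastic hA) T a) hx
  obtain ⟨m, rfl⟩ : ∃ m', m = m' + 1 := ⟨m - 1, by lia⟩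
  obtain ⟨-, -, i, hi, j, hj, -, hij⟩ := isLevelClass_succ.1 hT
  have hc0 : c = 0 := by
    by_contra h
    exact hij.ne' (hout h i hi j hj)
  ext k
  exact abs_eq_zero.1 ((hc k).trans hc0)

/-- The competitive drift matrix of a class that is not bipartite is invertible. -/
theorem IsCommunicatingClass.isUnit_driftMatrix_of_not_bipartite
    (hA : A ∈ Matrix.rowStochastic ℝ V) {T : Finset V} (hT : IsCommunicatingClass A T)
    (hbip : ¬ IsBipartiteOn A T) : IsUnit (driftMatrix A T .competitive) := by
  refine isUnit_driftMatrix_of_fixed fun x hx => ?_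
  obtain ⟨c, hc, hprod, -⟩ := hT.maximum_principle hA
    (abs_driftMatrix_add_one (fun _ _ => Matrix.nonneg_of_mem_rowStochastic hA) T .competitive) hx
  by_contra hx0
  have hc0 : c ≠ 0 := by
    rintro rfl
    exact hx0 (funext fun k => abs_eq_zero.1 (hc k))
  -- The sides are the signs of `x`: the equality case gives `x j * x i = -c ^ 2` along every edge
  -- inside `T`.
  refine hbip ⟨T.filter fun i => ∃ h : i ∈ T, 0 < x ⟨i, h⟩,
    T.filter fun i => ¬ ∃ h : i ∈ T, 0 < x ⟨i, h⟩, ?_, ?_, ?_⟩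
  · intro i
    simp only [Finset.mem_filter]
    tauto
  · exact Finset.disjoint_filter_filter_not _ _ _
  · intro i hi j hj hij
    have h1 := hprod ⟨i, hi⟩ ⟨j, hj⟩
    rw [driftMatrix_competitive_add_one_apply T (by simpa using hij.1)] at h1
    have h2 : x ⟨j, hj⟩ * x ⟨i, hi⟩ = -c ^ 2 := by
      have h3 : A i j * (x ⟨j, hj⟩ * x ⟨i, hi⟩) = A i j * -c ^ 2 := by
        simp only at h1; linarith
      exact mul_left_cancel₀ hij.2 h3
    have h4 : 0 < c ^ 2 := by positivity
    simp only [Finset.mem_filter, hi, hj, true_and, exists_true_left]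
    by_cases h5 : 0 < x ⟨i, hi⟩
    · refine Or.inl ⟨h5, fun h6 => ?_⟩
      nlinarith
    · refine Or.inr ⟨h5, ?_⟩
      by_contra h6
      nlinarith

/-- The diagonal block of a closed class is row-stochastic. -/
theorem IsLevelClass.block_mem_rowStochastic (hA : A ∈ Matrix.rowStochastic ℝ V) {R : Finset V}
    (hR : IsLevelClass A 0 R) : block A R R ∈ Matrix.rowStochastic ℝ R := by
  rw [Matrix.mem_rowStochastic_iff_sum]
  refine ⟨fun i j => Matrix.nonneg_of_mem_rowStochastic hA, fun i => ?_⟩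
  have h := hR.sum_row i.2 fun _ => 1
  simp only [mul_one, Finset.range_zero, Finset.sum_empty, add_zero,
    Matrix.sum_row_of_mem_rowStochastic hA] at h
  rw [h, ← Finset.sum_coe_sort R]
  rfl

/-- The only harmonic vectors of a closed class are the constants. -/
theorem IsLevelClass.harmonic_eq (hA : A ∈ Matrix.rowStochastic ℝ V) {R : Finset V}
    (hR : IsLevelClass A 0 R) {x : R → ℝ} (hx : block A R R *ᵥ x = x) (i j : R) : x i = x j := by
  have hcls := hR.isCommunicatingClass
  obtain ⟨c, hc, hprod, -⟩ := hcls.maximum_principle hA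
    (fun i j => abs_of_nonneg (Matrix.nonneg_of_mem_rowStochastic hA)) hx
  by_cases hc0 : c = 0
  · subst hc0
    rw [abs_eq_zero.1 (hc i), abs_eq_zero.1 (hc j)]
  have h := hcls.forall_of_propagates (p := fun k => ∀ h : k ∈ R, x i = x ⟨k, h⟩) ?_ i.2
    (fun _ => rfl) j j.2 j.2
  · exact h
  -- The equality case now gives `x l * x k = c ^ 2 = x k ^ 2` along edges, so the value itself
  -- propagates.
  intro k hk l hl _ hkl hpk _
  have h1 := hprod ⟨k, hk⟩ ⟨l, hl⟩
  have h2 : x ⟨l, hl⟩ * x ⟨k, hk⟩ = c ^ 2 := by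
    refine mul_left_cancel₀ hkl ?_
    rw [← mul_assoc]
    exact h1
  rw [← hc ⟨k, hk⟩, sq_abs, pow_two] at h2
  have h3 : x ⟨k, hk⟩ ≠ 0 := fun h => hc0 (by rw [← hc ⟨k, hk⟩, h, abs_zero])
  rw [hpk hk]
  exact (mul_right_cancel₀ h3 h2).symm

/-- A closed class carries a positive invariant distribution. -/
theorem IsLevelClass.exists_invariant (hA : A ∈ Matrix.rowStochastic ℝ V) {R : Finset V}
    (hR : IsLevelClass A 0 R) :
    ∃ v : R → ℝ, (∀ i, 0 < v i) ∧ v ᵥ* block A R R = v ∧ ∑ i, v i = 1 := by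
  have hcls := hR.isCommunicatingClass
  have hM := hR.block_mem_rowStochastic hA
  set M := block A R R with hMdef
  obtain ⟨i₀, hi₀⟩ := hcls.1
  have hdet : (M - 1).det = 0 := by
    refine Matrix.exists_mulVec_eq_zero_iff.1 ⟨1, fun h => ?_, ?_⟩
    · simpa using congrFun h ⟨i₀, hi₀⟩
    · rw [Matrix.sub_mulVec, Matrix.one_vecMul_of_mem_rowStochastic hM, Matrix.one_mulVec, sub_self]
  obtain ⟨w, hw, hw0⟩ := Matrix.exists_vecMul_eq_zero_iff.2 hdet
  rw [Matrix.vecMul_sub, Matrix.vecMul_one, sub_eq_zero] at hw0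
  have hM0 : ∀ i j, 0 ≤ M i j := fun i j => Matrix.nonneg_of_mem_rowStochastic hM
  -- The moduli of a left fixed vector are again invariant: they are subinvariant, and both sides
  -- have the same total because the rows sum to one.
  have hle : ∀ j, |w j| ≤ ∑ i, |w i| * M i j := by
    intro j
    have h1 : ∑ i, w i * M i j = w j := congrFun hw0 j
    rw [← h1]
    refine (Finset.abs_sum_le_sum_abs _ _).trans (Finset.sum_le_sum fun i _ => ?_)
    rw [abs_mul, abs_of_nonneg (hM0 i j)]
  have hsum : ∑ j, ∑ i, |w i| * M i j = ∑ i, |w i| := by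
    rw [Finset.sum_comm]
    refine Finset.sum_congr rfl fun i _ => ?_
    rw [← Finset.mul_sum, Matrix.sum_row_of_mem_rowStochastic hM, mul_one]
  have heq : ∀ j, ∑ i, |w i| * M i j = |w j| := by
    intro j
    have h1 := (Finset.sum_eq_sum_iff_of_le fun j _ => hle j).1 hsum.symm j (Finset.mem_univ j)
    exact h1.symm
  have hpos : ∀ i, 0 < |w i| := by
    obtain ⟨i₁, hi₁⟩ := Function.ne_iff.1 hw
    have h := hcls.forall_of_propagates (p := fun k => ∀ h : k ∈ R, 0 < |w ⟨k, h⟩|) ?_ i₁.2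
      (fun _ => abs_pos.2 hi₁)
    · exact fun i => h i i.2 i.2
    intro k hk l hl _ hkl hpk _
    rw [← heq]
    refine lt_of_lt_of_le (mul_pos (hpk hk) ((hM0 ⟨k, hk⟩ ⟨l, hl⟩).lt_of_ne' hkl)) ?_
    exact Finset.single_le_sum (f := fun i => |w i| * M i ⟨l, hl⟩)
      (fun i _ => mul_nonneg (abs_nonneg _) (hM0 _ _)) (Finset.mem_univ _)
  have : Nonempty R := ⟨⟨i₀, hi₀⟩⟩
  have htot : 0 < ∑ i, |w i| := Finset.sum_pos (fun i _ => hpos i) Finset.univ_nonempty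
  refine ⟨fun i => |w i| / ∑ i, |w i|, fun i => div_pos (hpos i) htot, ?_, ?_⟩
  · ext j
    simp only [Matrix.vecMul, dotProduct, div_mul_eq_mul_div]
    rw [← Finset.sum_div, heq]
  · rw [← Finset.sum_div, div_self htot.ne']

/-- In a closed class, every agent is charged by some row of the class. -/
theorem IsLevelClass.exists_pos_entry (hA : A ∈ Matrix.rowStochastic ℝ V) {R : Finset V}
    (hR : IsLevelClass A 0 R) {j : V} (hj : j ∈ R) : ∃ i ∈ R, 0 < A i j := by
  obtain ⟨v, hv0, hv, -⟩ := hR.exists_invariant hA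
  by_contra! h
  have h1 : ∑ i, v i * A i j = v ⟨j, hj⟩ := congrFun hv ⟨j, hj⟩
  have h2 : ∑ i, v i * A i j ≤ 0 :=
    Finset.sum_nonpos fun i _ => mul_nonpos_of_nonneg_of_nonpos (hv0 i).le (h i i.2)
  linarith [hv0 ⟨j, hj⟩]

end ClassBlocks

end ReinforcedNetwork

namespace ReinforcedNetwork

/-! ### The drift of the dynamics -/

section Forcing

variable {V : Type*} [Fintype V] {A : Matrix V V ℝ}

/-- The forcing exerted on the class `T` by the classes of level lower than `m`. -/
noncomputable def forcing (A : Matrix V V ℝ) (m : ℕ) (T : Finset V) (a : Attitude) (z : V → ℝ) : T → ℝ :=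
  driftConst A T a + ∑ t ∈ Finset.range m, ∑ S ∈ levelClasses A t,
    influence A T S a *ᵥ blockVec S z

theorem forcing_cooperative (m : ℕ) (T : Finset V) (z : V → ℝ) (i : T) :
    forcing A m T .cooperative z i =
      ∑ t ∈ Finset.range m, ∑ S ∈ levelClasses A t, ∑ j ∈ S, A i j * z j := by
  simp only [forcing, driftConst, influence, zero_add, Finset.sum_apply]
  refine Finset.sum_congr rfl fun t _ => Finset.sum_congr rfl fun S _ => ?_
  rw [← Finset.sum_coe_sort S]
  rfl

theorem forcing_competitive (m : ℕ) (T : Finset V) (z : V → ℝ) (i : T) :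
    forcing A m T .competitive z i = 1 - A i i -
      ∑ t ∈ Finset.range m, ∑ S ∈ levelClasses A t, ∑ j ∈ S, A i j * z j := by
  simp only [forcing, driftConst, influence, Pi.add_apply, Finset.sum_apply, sub_eq_add_neg,
    ← Finset.sum_neg_distrib, Matrix.neg_mulVec, Pi.neg_apply]
  congr 1
  refine Finset.sum_congr rfl fun t _ => Finset.sum_congr rfl fun S _ => ?_
  rw [Finset.sum_neg_distrib, ← Finset.sum_coe_sort S]
  rfl

end Forcing

/-! ### Success probabilities, affine drift and signings -/

section Drift

variable {V : Type*} [Fintype V] [DecidableEq V] {A : Matrix V V ℝ} {att : V → Attitude}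

theorem successProb_of_cooperative {i : V} (hi : att i = .cooperative) (z : V → ℝ) :
    successProb A att z i = ∑ j, A i j * z j := by
  rw [successProb, hi, ← Finset.add_sum_erase _ _ (Finset.mem_univ i)]
  rfl

/-- An agent does not compete with itself. Reflecting every state would give `1 - ∑ j, A i j * z j`;
restoring the diagonal term produces the `2 diag` of the competitive drift matrix. -/
theorem successProb_of_competitive (hA : A ∈ Matrix.rowStochastic ℝ V) {i : V}
    (hi : att i = .competitive) (z : V → ℝ) :
    successProb A att z i = 2 * (A i i * z i) + (1 - A i i) - ∑ j, A i j * z j := by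
  have h1 := Matrix.sum_row_of_mem_rowStochastic hA i
  rw [← Finset.add_sum_erase _ _ (Finset.mem_univ i)] at h1 ⊢
  simp only [successProb, hi, perceived, mul_sub, mul_one, Finset.sum_sub_distrib]
  linarith

theorem successProb_mem_Icc (hA : A ∈ Matrix.rowStochastic ℝ V) {z : V → ℝ}
    (hz : ∀ i, z i ∈ Set.Icc (0 : ℝ) 1) (i : V) :
    successProb A att z i ∈ Set.Icc (0 : ℝ) 1 := by
  have hA0 : ∀ j, 0 ≤ A i j := fun j => Matrix.nonneg_of_mem_rowStochastic hA
  have hp : ∀ j, perceived (att i) (z j) ∈ Set.Icc (0 : ℝ) 1 := by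
    intro j
    obtain ⟨h1, h2⟩ := hz j
    cases att i
    · exact ⟨h1, h2⟩
    · exact ⟨by simpa [perceived] using h2, by simpa [perceived] using h1⟩
  have h1 := Matrix.sum_row_of_mem_rowStochastic hA i
  rw [← Finset.add_sum_erase _ _ (Finset.mem_univ i)] at h1
  constructor
  · exact add_nonneg (mul_nonneg (hA0 i) (hz i).1)
      (Finset.sum_nonneg fun j _ => mul_nonneg (hA0 j) (hp j).1)
  · rw [← h1]
    exact add_le_add (mul_le_of_le_one_right (hA0 i) (hz i).2)
      (Finset.sum_le_sum fun j _ => mul_le_of_le_one_right (hA0 j) (hp j).2)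

/-- The drift of the agents of a class is affine in the states of the class and of the classes of
lower level. -/
theorem IsLevelClass.successProb_sub (hA : A ∈ Matrix.rowStochastic ℝ V) {m : ℕ} {T : Finset V}
    (hT : IsLevelClass A m T) {a : Attitude} (ha : ∀ i ∈ T, att i = a) (z : V → ℝ) (i : T) :
    successProb A att z i - z i =
      (driftMatrix A T a *ᵥ blockVec T z + forcing A m T a z) i := by
  have hblock : (block A T T *ᵥ blockVec T z) i = ∑ j ∈ T, A i j * z j := by
    rw [← Finset.sum_coe_sort T]
    rfl
  have hsum := hT.sum_row i.2 z
  cases a with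
  | cooperative =>
    rw [successProb_of_cooperative (ha i i.2), Pi.add_apply, forcing_cooperative, driftMatrix,
      Matrix.sub_mulVec, Pi.sub_apply, hblock, Matrix.one_mulVec, hsum]
    simp only [blockVec]
    ring
  | competitive =>
    have hdiag : (((2 : ℝ) • Matrix.diagonal (block A T T).diag) *ᵥ blockVec T z) i =
        2 * (A i i * z i) := by
      rw [Matrix.smul_mulVec, Pi.smul_apply, Matrix.mulVec_diagonal]
      rfl
    rw [successProb_of_competitive hA (ha i i.2), Pi.add_apply, forcing_competitive, driftMatrix,
      Matrix.sub_mulVec, Matrix.sub_mulVec, Pi.sub_apply, Pi.sub_apply, hblock, hdiag,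
      Matrix.one_mulVec, hsum]
    simp only [blockVec]
    ring

/-- The signs `σ` make the class `R` cooperative: after the change of variables
`z ↦ σ (z - 1/2)`, the success probabilities on `R` are averages of the states on `R`. -/
def IsSigning (A : Matrix V V ℝ) (att : V → Attitude) (R : Finset V) (σ : V → ℝ) : Prop :=
  (∀ i ∈ R, σ i = 1 ∨ σ i = -1) ∧ ∀ z, ∀ i ∈ R,
    σ i * (successProb A att z i - 1 / 2) = ∑ j ∈ R, A i j * (σ j * (z j - 1 / 2))

theorem IsLevelClass.isSigning_of_cooperative (hA : A ∈ Matrix.rowStochastic ℝ V) {R : Finset V}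
    (hR : IsLevelClass A 0 R) (ha : ∀ i ∈ R, att i = .cooperative) :
    IsSigning A att R fun _ => 1 := by
  refine ⟨fun _ _ => Or.inl rfl, fun z i hi => ?_⟩
  have h1 := Matrix.sum_row_of_mem_rowStochastic hA i
  have h2 := hR.sum_row hi fun j => z j - 1 / 2
  simp only [Finset.range_zero, Finset.sum_empty, add_zero] at h2
  simp only [one_mul]
  rw [← h2, successProb_of_cooperative (ha i hi)]
  simp only [mul_sub, Finset.sum_sub_distrib, ← Finset.sum_mul, h1, one_mul]

/-- Around `1 / 2`, competition is a change of sign across each edge; crossing the bipartition also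
changes `σ`, and the two signs cancel. The diagonal term undergoes neither change. -/
theorem IsLevelClass.isSigning_of_isBipartition (hA : A ∈ Matrix.rowStochastic ℝ V) {R : Finset V}
    (hR : IsLevelClass A 0 R) (ha : ∀ i ∈ R, att i = .competitive) {I J : Finset V}
    (hIJ : IsBipartition A R I J) : IsSigning A att R fun i => if i ∈ I then 1 else -1 := by
  obtain ⟨hmem, hdisj, hedge⟩ := hIJ
  refine ⟨fun i _ => by by_cases h : i ∈ I <;> simp [h], fun z i hi => ?_⟩
  set σ : V → ℝ := fun i => if i ∈ I then 1 else -1 with hσ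
  have hσi : σ i * σ i = 1 := by
    by_cases h : i ∈ I <;> simp [hσ, h]
  have h1 := Matrix.sum_row_of_mem_rowStochastic hA i
  have h2 := hR.sum_row hi fun j => z j - 1 / 2
  have hiR := Finset.add_sum_erase R (fun j => A i j * (z j - 1 / 2)) hi
  simp only [Finset.range_zero, Finset.sum_empty, add_zero] at h2
  have h3 : ∀ j ∈ R.erase i, A i j * (σ j * (z j - 1 / 2)) =
      -(σ i * (A i j * (z j - 1 / 2))) := by
    intro j hj
    obtain ⟨hji, hjR⟩ := Finset.mem_erase.1 hj
    by_cases hij : A i j = 0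
    · simp [hij]
    have h4 : σ j = -σ i := by
      rcases hedge i hi j hjR ⟨hji.symm, hij⟩ with ⟨h5, h6⟩ | ⟨h5, h6⟩
      · have h7 : j ∉ I := fun h => Finset.disjoint_left.1 hdisj h h6
        simp [hσ, h5, h7]
      · have h7 : i ∉ I := fun h => Finset.disjoint_left.1 hdisj h h5
        simp [hσ, h6, h7]
    rw [h4]
    ring
  change σ i * _ = ∑ j ∈ R, A i j * (σ j * (z j - 1 / 2))
  rw [← Finset.add_sum_erase R _ hi, Finset.sum_congr rfl h3, Finset.sum_neg_distrib,
    ← Finset.mul_sum, successProb_of_competitive hA (ha i hi)]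
  have h4 : ∑ j, A i j * (z j - 1 / 2) = ∑ j, A i j * z j - 1 / 2 := by
    simp only [mul_sub, Finset.sum_sub_distrib, ← Finset.sum_mul, h1, one_mul]
  have h5 : ∑ j ∈ R.erase i, A i j * (z j - 1 / 2) =
      ∑ j, A i j * z j - 1 / 2 - A i i * (z i - 1 / 2) := by linarith
  rw [h5]
  ring

end Drift

/-! ### Convergence of the trajectories -/

section Trajectory

variable {V : Type*} [Fintype V] [DecidableEq V] {A : Matrix V V ℝ} {att : V → Attitude}

/-- `z` is a trajectory of the stochastic approximation scheme of the network, with noise `e`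
whose series converges. -/
structure IsTrajectory (A : Matrix V V ℝ) (att : V → Attitude) (r : ℕ → ℝ) (z e : ℕ → V → ℝ) :
    Prop where
  step : ∀ n i, z (n + 1) i = z n i + r n * (successProb A att (z n) i - z n i) + e n i
  noise : ∀ i, ∃ s, Tendsto (fun n => ∑ k ∈ Finset.range n, e k i) atTop (𝓝 s)
  rate_nonneg : ∀ n, 0 ≤ r n
  rate_sum : Tendsto (fun n => ∑ k ∈ Finset.range n, r k) atTop atTop
  rate_zero : Tendsto r atTop (𝓝 0)

variable {r : ℕ → ℝ} {z e : ℕ → V → ℝ}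

/-- A class with invertible drift matrix follows the limits of the classes of lower level. -/
theorem IsTrajectory.tendsto_blockVec (hz : IsTrajectory A att r z e)
    (hA : A ∈ Matrix.rowStochastic ℝ V) {m : ℕ} {T : Finset V} (hT : IsLevelClass A m T)
    {a : Attitude} (ha : ∀ i ∈ T, att i = a) (hK : IsUnit (driftMatrix A T a)) {l : V → ℝ}
    (hl : ∀ t < m, ∀ S, IsLevelClass A t S → ∀ j ∈ S, Tendsto (fun n => z n j) atTop (𝓝 (l j))) :
    Tendsto (fun n => blockVec T (z n)) atTop
      (𝓝 (-((driftMatrix A T a)⁻¹ *ᵥ forcing A m T a l))) := by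
  choose s hs using hz.noise
  have hsub : driftMatrix A T a + 1 - 1 = driftMatrix A T a := add_sub_cancel_right _ _
  have h := tendsto_of_affine_recursion (sum_abs_driftMatrix_add_one_le hA T a)
    (by rwa [hsub]) hz.rate_nonneg hz.rate_sum hz.rate_zero
    (x := fun n => blockVec T (z n)) (b := fun n => forcing A m T a (z n))
    (b' := forcing A m T a l) (e := fun n => blockVec T (e n)) (s := blockVec T s) ?_ ?_ ?_
  · rwa [hsub] at h
  · refine tendsto_const_nhds.add (tendsto_finsetSum _ fun t ht => tendsto_finsetSum _ fun S hS => ?_)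
    have h1 : Tendsto (fun n => blockVec S (z n)) atTop (𝓝 (blockVec S l)) :=
      tendsto_pi_nhds.2 fun j => hl t (Finset.mem_range.1 ht) S (mem_levelClasses.1 hS) j j.2
    exact ((influence A T S a).mulVecLin.continuous_of_finiteDimensional.tendsto _).comp h1
  · refine tendsto_pi_nhds.2 fun i => ?_
    simpa [Finset.sum_apply, blockVec] using hs i
  · intro n
    ext i
    rw [hsub]
    simp only [Pi.add_apply, Pi.smul_apply, smul_eq_mul]
    have h1 := hT.successProb_sub hA ha (z n) i
    rw [Pi.add_apply] at h1
    rw [← h1]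
    exact hz.step n i

/-- After the change of variables given by a signing, the states of a closed class tend to a
consensus. -/
theorem IsTrajectory.tendsto_of_isSigning (hz : IsTrajectory A att r z e)
    (hA : A ∈ Matrix.rowStochastic ℝ V) {R : Finset V} (hR : IsLevelClass A 0 R) {σ : V → ℝ}
    (hσ : IsSigning A att R σ) :
    ∃ c : ℝ, ∀ i ∈ R, Tendsto (fun n => σ i * (z n i - 1 / 2)) atTop (𝓝 c) := by
  choose s hs using hz.noise
  obtain ⟨v, -, hv, hv1⟩ := hR.exists_invariant hA
  obtain ⟨c, hc⟩ := tendsto_consensus_of_recursion (hR.block_mem_rowStochastic hA) hv hv1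
    (fun x hx i j => hR.harmonic_eq hA hx i j) hz.rate_nonneg hz.rate_sum hz.rate_zero
    (x := fun n i => σ i * (z n i - 1 / 2)) (e := fun n i => σ i * e n i) (s := fun i => σ i * s i)
    (by
      refine tendsto_pi_nhds.2 fun i => ?_
      simpa [Finset.sum_apply, Finset.mul_sum] using (hs i).const_mul (σ i))
    (by
      intro n
      ext i
      have h1 : (block A R R *ᵥ fun i => σ i * (z n i - 1 / 2)) i =
          σ i * (successProb A att (z n) i - 1 / 2) := by
        rw [hσ.2 _ _ i.2, ← Finset.sum_coe_sort R]
        rfl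
      simp only [Pi.add_apply, Pi.smul_apply, smul_eq_mul, Matrix.sub_mulVec, Pi.sub_apply, h1,
        Matrix.one_mulVec, hz.step n i]
      ring)
  exact ⟨c, fun i hi => hc ⟨i, hi⟩⟩

/-- If all the agents of each class have the same attitude, every trajectory converges. -/
theorem IsTrajectory.exists_tendsto (hz : IsTrajectory A att r z e)
    (hA : A ∈ Matrix.rowStochastic ℝ V)
    (hatt : ∀ m T, IsLevelClass A m T → ∃ a, ∀ i ∈ T, att i = a) :
    ∃ l, Tendsto z atTop (𝓝 l) := by
  have hsign : ∀ R, IsLevelClass A 0 R → ∀ σ, IsSigning A att R σ →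
      ∀ i ∈ R, ∃ l, Tendsto (fun n => z n i) atTop (𝓝 l) := by
    intro R hR σ hσ i hi
    obtain ⟨c, hc⟩ := hz.tendsto_of_isSigning hA hR hσ
    have hσi : σ i * σ i = 1 := by rcases hσ.1 i hi with h | h <;> simp [h]
    refine ⟨σ i * c + 1 / 2, (((hc i hi).const_mul (σ i)).add_const (1 / 2)).congr fun n => ?_⟩
    rw [← mul_assoc, hσi]
    ring
  have key : ∀ m T, IsLevelClass A m T → ∀ i ∈ T, ∃ l, Tendsto (fun n => z n i) atTop (𝓝 l) := by
    intro m
    induction m using Nat.strong_induction_on with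
    | _ m ih =>
      intro T hT i hi
      obtain ⟨a, ha⟩ := hatt m T hT
      have hK : IsUnit (driftMatrix A T a) → ∃ l, Tendsto (fun n => z n i) atTop (𝓝 l) := by
        intro hK
        -- Agents in no lower class get the dummy value 0, which the forcing never reads.
        have hlim : ∀ j, ∃ l, ∀ t < m, ∀ S, IsLevelClass A t S → j ∈ S →
            Tendsto (fun n => z n j) atTop (𝓝 l) := by
          intro j
          by_cases h : ∃ t < m, ∃ S, IsLevelClass A t S ∧ j ∈ S
          · obtain ⟨t, ht, S, hS, hj⟩ := h
            obtain ⟨l, hl⟩ := ih t ht S hS j hj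
            exact ⟨l, fun _ _ _ _ _ => hl⟩
          · exact ⟨0, fun t ht S hS hj => (h ⟨t, ht, S, hS, hj⟩).elim⟩
        choose l hl using hlim
        exact ⟨_, tendsto_pi_nhds.1 (hz.tendsto_blockVec hA hT ha hK
          fun t ht S hS j hj => hl j t ht S hS hj) ⟨i, hi⟩⟩
      rcases Nat.eq_zero_or_pos m with rfl | hm
      · cases a with
        | cooperative => exact hsign T hT _ (hT.isSigning_of_cooperative hA ha) i hi
        | competitive =>
          by_cases hbip : IsBipartiteOn A T
          · obtain ⟨I, J, hIJ⟩ := hbip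
            exact hsign T hT _ (hT.isSigning_of_isBipartition hA ha hIJ) i hi
          · exact hK (hT.isCommunicatingClass.isUnit_driftMatrix_of_not_bipartite hA hbip)
      · exact hK (hT.isUnit_driftMatrix hA hm a)
  have hall : ∀ i, ∃ l, Tendsto (fun n => z n i) atTop (𝓝 l) := by
    intro i
    obtain ⟨m, T, hT, hi⟩ :=
      exists_isLevelClass (fun _ _ => Matrix.nonneg_of_mem_rowStochastic hA) i
    exact key m T hT i hi
  choose l hl using hall
  exact ⟨l, tendsto_pi_nhds.2 hl⟩

/-- The limit on a competitive class of level zero that is not bipartite is `1 / 2`. -/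
theorem IsTrajectory.eq_half_of_not_bipartite (hz : IsTrajectory A att r z e)
    (hA : A ∈ Matrix.rowStochastic ℝ V) {R : Finset V} (hR : IsLevelClass A 0 R)
    (ha : ∀ i ∈ R, att i = .competitive) (hbip : ¬ IsBipartiteOn A R) {l : V → ℝ}
    (hl : Tendsto z atTop (𝓝 l)) : ∀ i ∈ R, l i = 1 / 2 := by
  intro i hi
  have hK := hR.isCommunicatingClass.isUnit_driftMatrix_of_not_bipartite hA hbip
  -- At level 0 there are no lower classes, so `l` is arbitrary; the constant `1 / 2` is taken
  -- because it is a zero of the full drift.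
  have h := hz.tendsto_blockVec hA hR ha hK (l := fun _ => 1 / 2) (by simp)
  have h1 : driftMatrix A R .competitive *ᵥ (fun _ => 1 / 2) +
      forcing A 0 R .competitive (fun _ => 1 / 2) = 0 := by
    ext j
    refine (hR.successProb_sub hA ha (fun _ => 1 / 2) j).symm.trans ?_
    rw [successProb_of_competitive hA (ha j j.2), ← Finset.sum_mul,
      Matrix.sum_row_of_mem_rowStochastic hA, Pi.zero_apply]
    ring
  have hdet := (Matrix.isUnit_iff_isUnit_det _).1 hK
  rw [← neg_eq_of_add_eq_zero_right h1, Matrix.mulVec_neg, Matrix.mulVec_mulVec,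
    Matrix.nonsing_inv_mul _ hdet, Matrix.one_mulVec, neg_neg] at h
  exact tendsto_nhds_unique (tendsto_pi_nhds.1 hl i) (tendsto_pi_nhds.1 h ⟨i, hi⟩)

end Trajectory

end ReinforcedNetwork

namespace ReinforcedNetwork

/-! ### The noise of the dynamics -/

section Noise

variable {V : Type*} [Fintype V] [DecidableEq V] {A : Matrix V V ℝ} {att : V → Attitude}
  {Ω : Type*} {mΩ : MeasurableSpace Ω} {μ : Measure Ω} {ℱ : Filtration ℕ mΩ} {r : ℕ → ℝ}
  {Z Y : ℕ → Ω → V → ℝ}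

/-- The difference between a driving variable and its conditional expectation. -/
def noise (A : Matrix V V ℝ) (att : V → Attitude) (Z Y : ℕ → Ω → V → ℝ) (n : ℕ) (i : V) (ω : Ω) :
    ℝ :=
  Y (n + 1) ω i - successProb A att (Z n ω) i

namespace IsReinforcedSystem

theorem step_noise (hZ : IsReinforcedSystem μ ℱ A att r Z Y) (n : ℕ) (ω : Ω) (i : V) :
    Z (n + 1) ω i = Z n ω i + r n * (successProb A att (Z n ω) i - Z n ω i) +
      r n * noise A att Z Y n i ω := by
  rw [hZ.step, noise]
  ring

theorem driving_mem_Icc (hZ : IsReinforcedSystem μ ℱ A att r Z Y) (n : ℕ) (ω : Ω) (i : V) :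
    Y (n + 1) ω i ∈ Set.Icc (0 : ℝ) 1 := by
  rcases hZ.driving_mem n ω i with h | h <;> simp [h]

theorem state_mem_Icc (hZ : IsReinforcedSystem μ ℱ A att r Z Y)
    (hr : ∀ n, r n ∈ Set.Ioo (0 : ℝ) 1) (n : ℕ) (ω : Ω) (i : V) :
    Z n ω i ∈ Set.Icc (0 : ℝ) 1 := by
  induction n with
  | zero => exact hZ.init_mem ω i
  | succ n ih =>
    rw [hZ.step]
    exact (convex_Icc (0 : ℝ) 1) ih (hZ.driving_mem_Icc n ω i) (by linarith [(hr n).2])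
      (hr n).1.le (by ring)

theorem state_measurable (hZ : IsReinforcedSystem μ ℱ A att r Z Y) (n : ℕ) (i : V) :
    Measurable[ℱ n] fun ω => Z n ω i := by
  induction n with
  | zero => exact hZ.init_measurable i
  | succ n ih =>
    simp_rw [hZ.step]
    exact ((ih.mono (ℱ.mono n.le_succ) le_rfl).const_mul _).add
      ((hZ.driving_measurable n i).const_mul _)

theorem successProb_measurable (hZ : IsReinforcedSystem μ ℱ A att r Z Y) (n : ℕ) (i : V) :
    Measurable[ℱ n] fun ω => successProb A att (Z n ω) i := by
  have h : ∀ a, Measurable (perceived a) := by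
    intro a
    cases a
    · exact measurable_id
    · exact measurable_const.sub measurable_id
  exact ((hZ.state_measurable n i).const_mul _).add
    (Finset.measurable_fun_sum _ fun j _ => ((h _).comp (hZ.state_measurable n j)).const_mul _)

theorem noise_measurable (hZ : IsReinforcedSystem μ ℱ A att r Z Y) (n : ℕ) (i : V) :
    Measurable[ℱ (n + 1)] (noise A att Z Y n i) :=
  (hZ.driving_measurable n i).sub ((hZ.successProb_measurable n i).mono (ℱ.mono n.le_succ) le_rfl)

theorem abs_noise_le (hZ : IsReinforcedSystem μ ℱ A att r Z Y)
    (hA : A ∈ Matrix.rowStochastic ℝ V) (hr : ∀ n, r n ∈ Set.Ioo (0 : ℝ) 1) (n : ℕ) (i : V)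
    (ω : Ω) : |noise A att Z Y n i ω| ≤ 1 := by
  obtain ⟨h1, h2⟩ := hZ.driving_mem_Icc n ω i
  obtain ⟨h3, h4⟩ := successProb_mem_Icc (att := att) hA (fun j => hZ.state_mem_Icc hr n ω j) i
  rw [noise, abs_le]
  constructor <;> linarith

end IsReinforcedSystem

/-- A bounded measurable function is integrable for a finite measure. -/
theorem integrable_of_abs_le [IsFiniteMeasure μ] {f : Ω → ℝ} (hf : Measurable f) {C : ℝ}
    (h : ∀ ω, |f ω| ≤ C) : Integrable f μ :=
  Integrable.of_bound hf.aestronglyMeasurable C (ae_of_all _ h)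

namespace IsReinforcedSystem

theorem driving_eq_indicator (hZ : IsReinforcedSystem μ ℱ A att r Z Y) (n : ℕ) (i : V) :
    (fun ω => Y (n + 1) ω i) = {ω | Y (n + 1) ω i = 1}.indicator fun _ => (1 : ℝ) := by
  ext ω
  rcases hZ.driving_mem n ω i with h | h <;> simp [h, Set.indicator]

theorem measurableSet_driving (hZ : IsReinforcedSystem μ ℱ A att r Z Y) (n : ℕ) (i : V) :
    MeasurableSet {ω | Y (n + 1) ω i = 1} :=
  (hZ.driving_measurable n i).mono (ℱ.le _) le_rfl (measurableSet_singleton 1)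

variable [IsProbabilityMeasure μ]

theorem successProb_integrable (hZ : IsReinforcedSystem μ ℱ A att r Z Y)
    (hA : A ∈ Matrix.rowStochastic ℝ V) (hr : ∀ n, r n ∈ Set.Ioo (0 : ℝ) 1) (n : ℕ) (i : V) :
    Integrable (fun ω => successProb A att (Z n ω) i) μ := by
  refine integrable_of_abs_le ((hZ.successProb_measurable n i).mono (ℱ.le _) le_rfl) (C := 1)
    fun ω => ?_
  obtain ⟨h3, h4⟩ := successProb_mem_Icc (att := att) hA (fun j => hZ.state_mem_Icc hr n ω j) i
  rw [abs_le]
  constructor <;> linarith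

theorem noise_integrable (hZ : IsReinforcedSystem μ ℱ A att r Z Y)
    (hA : A ∈ Matrix.rowStochastic ℝ V) (hr : ∀ n, r n ∈ Set.Ioo (0 : ℝ) 1) (n : ℕ) (i : V) :
    Integrable (noise A att Z Y n i) μ :=
  integrable_of_abs_le ((hZ.noise_measurable n i).mono (ℱ.le _) le_rfl)
    (hZ.abs_noise_le hA hr n i)

theorem condExp_noise (hZ : IsReinforcedSystem μ ℱ A att r Z Y)
    (hA : A ∈ Matrix.rowStochastic ℝ V) (hr : ∀ n, r n ∈ Set.Ioo (0 : ℝ) 1) (n : ℕ) (i : V) :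
    μ[noise A att Z Y n i | ℱ n] =ᵐ[μ] 0 := by
  have hp := hZ.successProb_integrable hA hr n i
  have hY : Integrable (fun ω => Y (n + 1) ω i) μ := by
    rw [hZ.driving_eq_indicator]
    exact (integrable_const _).indicator (hZ.measurableSet_driving n i)
  have h1 := condExp_sub hY hp (ℱ n)
  rw [condExp_of_stronglyMeasurable (ℱ.le n) (hZ.successProb_measurable n i).stronglyMeasurable hp,
    hZ.driving_eq_indicator] at h1
  have h2 : noise A att Z Y n i = {ω | Y (n + 1) ω i = 1}.indicator (fun _ => (1 : ℝ)) -
      fun ω => successProb A att (Z n ω) i := by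
    rw [← hZ.driving_eq_indicator]
    rfl
  rw [h2]
  filter_upwards [h1, hZ.driving_prob n i] with ω h3 h4
  rw [h3, Pi.sub_apply, h4, sub_self, Pi.zero_apply]

/-- The noise is orthogonal to the bounded functions of the past. -/
theorem integral_mul_noise (hZ : IsReinforcedSystem μ ℱ A att r Z Y)
    (hA : A ∈ Matrix.rowStochastic ℝ V) (hr : ∀ n, r n ∈ Set.Ioo (0 : ℝ) 1) (n : ℕ) (i : V)
    {g : Ω → ℝ} (hg : Measurable[ℱ n] g) {C : ℝ} (hC : ∀ ω, |g ω| ≤ C) :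
    ∫ ω, g ω * noise A att Z Y n i ω ∂μ = 0 := by
  have h1 := condExp_stronglyMeasurable_mul_of_bound (ℱ.le n) hg.stronglyMeasurable
    (hZ.noise_integrable hA hr n i) C (ae_of_all _ hC)
  have h2 : μ[g * noise A att Z Y n i | ℱ n] =ᵐ[μ] 0 := by
    filter_upwards [h1, hZ.condExp_noise hA hr n i] with ω h3 h4
    rw [h3, Pi.mul_apply, h4, Pi.zero_apply, mul_zero]
  calc ∫ ω, g ω * noise A att Z Y n i ω ∂μ
      = ∫ ω, (μ[g * noise A att Z Y n i | ℱ n]) ω ∂μ := (integral_condExp (ℱ.le n)).symm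
    _ = 0 := by rw [integral_congr_ae h2]; simp

/-- The series of the weighted noises converges almost surely. -/
theorem ae_exists_tendsto_sum_noise (hZ : IsReinforcedSystem μ ℱ A att r Z Y)
    (hA : A ∈ Matrix.rowStochastic ℝ V) (hr : ∀ n, r n ∈ Set.Ioo (0 : ℝ) 1)
    (hr_sq : Summable fun n => r n ^ 2) (i : V) :
    ∀ᵐ ω ∂μ, ∃ s, Tendsto (fun n => ∑ k ∈ Finset.range n, r k * noise A att Z Y k i ω) atTop
      (𝓝 s) := by
  set N : ℕ → Ω → ℝ := fun n ω => ∑ k ∈ Finset.range n, r k * noise A att Z Y k i ω with hN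
  have hsucc : ∀ n ω, N (n + 1) ω = N n ω + r n * noise A att Z Y n i ω := fun n ω =>
    Finset.sum_range_succ _ _
  have hmeas : ∀ n, Measurable[ℱ n] (N n) := fun n =>
    Finset.measurable_fun_sum _ fun k hk => ((hZ.noise_measurable k i).mono
      (ℱ.mono (Finset.mem_range.1 hk)) le_rfl).const_mul _
  have hmeas' : ∀ n, Measurable (N n) := fun n => (hmeas n).mono (ℱ.le n) le_rfl
  have hbound : ∀ n ω, |N n ω| ≤ n := by
    intro n ω
    refine (Finset.abs_sum_le_sum_abs _ _).trans ?_
    refine (Finset.sum_le_card_nsmul _ _ 1 fun k _ => ?_).trans (by simp)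
    rw [abs_mul, abs_of_pos (hr k).1]
    exact mul_le_one₀ (hr k).2.le (abs_nonneg _) (hZ.abs_noise_le hA hr k i ω)
  have hint : ∀ n, Integrable (N n) μ := fun n => integrable_of_abs_le (hmeas' n) (hbound n)
  have hnoise := hZ.noise_integrable (μ := μ) hA hr
  have hmart : Martingale N ℱ μ := by
    refine martingale_of_setIntegral_eq_succ (fun n => (hmeas n).stronglyMeasurable) hint
      fun n s hs => ?_
    have h1 : ∫ ω in s, noise A att Z Y n i ω ∂μ = 0 := by
      rw [← integral_indicator (ℱ.le n s hs), ← hZ.integral_mul_noise hA hr n i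
        (g := s.indicator fun _ => 1) (measurable_const.indicator hs) (C := 1)]
      · refine integral_congr_ae (ae_of_all _ fun ω => ?_)
        by_cases h : ω ∈ s <;> simp [h]
      · intro ω
        by_cases h : ω ∈ s <;> simp [h]
    simp_rw [hsucc]
    rw [integral_add (hint n).integrableOn ((hnoise n i).const_mul _).integrableOn,
      integral_const_mul, h1, mul_zero, add_zero]
  have hsq_int : ∀ n, Integrable (fun ω => N n ω ^ 2) μ := fun n =>
    integrable_of_abs_le ((hmeas' n).pow_const 2) (C := (n : ℝ) ^ 2) fun ω => by
      rw [abs_pow]; exact pow_le_pow_left₀ (abs_nonneg _) (hbound n ω) 2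
  have hnsq_int : ∀ n, Integrable (fun ω => noise A att Z Y n i ω ^ 2) μ := fun n =>
    integrable_of_abs_le (((hZ.noise_measurable n i).mono (ℱ.le _) le_rfl).pow_const 2) (C := 1)
      fun ω => by rw [abs_pow]; exact pow_le_one₀ (abs_nonneg _) (hZ.abs_noise_le hA hr n i ω)
  have hcross_int : ∀ n, Integrable (fun ω => N n ω * noise A att Z Y n i ω) μ := fun n =>
    integrable_of_abs_le ((hmeas' n).mul ((hZ.noise_measurable n i).mono (ℱ.le _) le_rfl))
      (C := n) fun ω => by
        rw [abs_mul]
        exact mul_le_of_le_one_right (abs_nonneg _) (hZ.abs_noise_le hA hr n i ω) |>.trans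
          (hbound n ω)
  -- Increments are orthogonal to the past and bounded by `r k`. With `|x| ≤ 1 + x ^ 2` this bounds
  -- the martingale in L¹, as the convergence theorem requires.
  have hsq : ∀ n, ∫ ω, N n ω ^ 2 ∂μ ≤ ∑ k ∈ Finset.range n, r k ^ 2 := by
    intro n
    induction n with
    | zero => simp [hN]
    | succ n ih =>
      have h1 : ∀ ω, N (n + 1) ω ^ 2 = N n ω ^ 2 +
          (2 * r n * (N n ω * noise A att Z Y n i ω) + r n ^ 2 * noise A att Z Y n i ω ^ 2) := by
        intro ω
        rw [hsucc]
        ring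
      simp_rw [h1]
      have h4 : Integrable (fun ω => 2 * r n * (N n ω * noise A att Z Y n i ω) +
          r n ^ 2 * noise A att Z Y n i ω ^ 2) μ :=
        ((hcross_int n).const_mul _).add ((hnsq_int n).const_mul _)
      rw [integral_add (hsq_int n) h4,
        integral_add ((hcross_int n).const_mul _) ((hnsq_int n).const_mul _), integral_const_mul,
        integral_const_mul, hZ.integral_mul_noise hA hr n i (hmeas n) (hbound n),
        Finset.sum_range_succ, mul_zero, zero_add]
      have h2 : ∫ ω, noise A att Z Y n i ω ^ 2 ∂μ ≤ 1 := by
        calc ∫ ω, noise A att Z Y n i ω ^ 2 ∂μ ≤ ∫ _, (1 : ℝ) ∂μ :=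
              integral_mono (hnsq_int n) (integrable_const _) fun ω =>
                (sq_le_one_iff_abs_le_one _).2 (hZ.abs_noise_le hA hr n i ω)
          _ = 1 := by simp
      have h3 := mul_le_mul_of_nonneg_left h2 (sq_nonneg (r n))
      linarith
  refine hmart.submartingale.exists_ae_tendsto_of_bdd
    (R := (1 + ∑' k, r k ^ 2).toNNReal) fun n => ?_
  rw [eLpNorm_one_eq_lintegral_enorm, ← ofReal_integral_norm_eq_lintegral_enorm (hint n)]
  refine ENNReal.ofReal_le_ofReal ?_
  calc ∫ ω, ‖N n ω‖ ∂μ ≤ ∫ ω, (1 + N n ω ^ 2) ∂μ := by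
        refine integral_mono (hint n).norm ((integrable_const _).add (hsq_int n)) fun ω => ?_
        simp only [Real.norm_eq_abs]
        rw [← sq_abs]
        nlinarith [sq_nonneg (|N n ω| - 1)]
    _ = 1 + ∫ ω, N n ω ^ 2 ∂μ := by rw [integral_add (integrable_const _) (hsq_int n)]; simp
    _ ≤ 1 + ∑' k, r k ^ 2 := by
        have := (hsq n).trans (hr_sq.sum_le_tsum _ fun k _ => sq_nonneg (r k))
        linarith

/-- Almost every realisation of the system is a trajectory of the stochastic approximation
scheme. -/
theorem ae_isTrajectory (hZ : IsReinforcedSystem μ ℱ A att r Z Y)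
    (hA : A ∈ Matrix.rowStochastic ℝ V) (hr : ∀ n, r n ∈ Set.Ioo (0 : ℝ) 1)
    (hr_sum : Tendsto (fun n => ∑ k ∈ Finset.range n, r k) atTop atTop)
    (hr_sq : Summable fun n => r n ^ 2) :
    ∀ᵐ ω ∂μ, IsTrajectory A att r (fun n => Z n ω) fun n i => r n * noise A att Z Y n i ω := by
  filter_upwards [ae_all_iff.2 (hZ.ae_exists_tendsto_sum_noise hA hr hr_sq)] with ω hω
  refine ⟨fun n i => hZ.step_noise n ω i, hω, fun n => (hr n).1.le, hr_sum, ?_⟩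
  have h := hr_sq.tendsto_atTop_zero.sqrt
  simpa [Real.sqrt_sq (hr _).1.le] using h

/-- Under conditional independence, the noises of distinct agents are orthogonal. -/
theorem integral_noise_mul_noise (hZ : IsReinforcedSystem μ ℱ A att r Z Y)
    (hA : A ∈ Matrix.rowStochastic ℝ V) (hr : ∀ n, r n ∈ Set.Ioo (0 : ℝ) 1) {R : Finset V}
    (hind : CondIndepDriving μ ℱ Y R) (n : ℕ) {i j : V} (hi : i ∈ R) (hj : j ∈ R) (hij : i ≠ j) :
    ∫ ω, noise A att Z Y n i ω * noise A att Z Y n j ω ∂μ = 0 := by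
  set p : V → Ω → ℝ := fun i ω => successProb A att (Z n ω) i with hp
  have hpm : ∀ i, Measurable[ℱ n] (p i) := fun i => hZ.successProb_measurable n i
  have hpm' : ∀ i, Measurable (p i) := fun i => (hpm i).mono (ℱ.le n) le_rfl
  have hp1 : ∀ i ω, |p i ω| ≤ 1 := by
    intro i ω
    obtain ⟨h3, h4⟩ := successProb_mem_Icc (att := att) hA (fun j => hZ.state_mem_Icc hr n ω j) i
    rw [abs_le]
    constructor <;> simp only [hp] <;> linarith
  have hξm : ∀ i, Measurable (noise A att Z Y n i) := fun i =>
    (hZ.noise_measurable n i).mono (ℱ.le _) le_rfl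
  have hprod : ∀ {f g : Ω → ℝ}, (∀ ω, |f ω| ≤ 1) → (∀ ω, |g ω| ≤ 1) → ∀ ω, |f ω * g ω| ≤ 1 := by
    intro f g hf hg ω
    rw [abs_mul]
    exact mul_le_one₀ (hf ω) (abs_nonneg _) (hg ω)
  set E : Set Ω := {ω | Y (n + 1) ω i = 1} ∩ {ω | Y (n + 1) ω j = 1} with hE
  have hEm : MeasurableSet E := (hZ.measurableSet_driving n i).inter (hZ.measurableSet_driving n j)
  have hcond : μ⟦E | ℱ n⟧ =ᵐ[μ] fun ω => p i ω * p j ω := by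
    have h1 := hind n {i, j} (by simp [Finset.insert_subset_iff, hi, hj]) (fun _ => {1})
      fun _ => measurableSet_singleton _
    rw [Finset.prod_pair hij] at h1
    have h2 : ⋂ k ∈ ({i, j} : Finset V), {ω | Y (n + 1) ω k ∈ ({1} : Set ℝ)} = E := by
      ext ω
      simp [hE]
    rw [h2] at h1
    filter_upwards [h1, hZ.driving_prob n i, hZ.driving_prob n j] with ω h3 h4 h5
    simp only [Set.mem_singleton_iff] at h3
    rw [h3, Pi.mul_apply, h4, h5]
  have hEint : ∫ ω, E.indicator (fun _ => (1 : ℝ)) ω ∂μ = ∫ ω, p i ω * p j ω ∂μ := by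
    rw [← integral_congr_ae hcond, integral_condExp (ℱ.le n)]
  -- The first bracket has mean zero by conditional independence; the second is noise times
  -- functions of the past.
  have hdecomp : ∀ ω, noise A att Z Y n i ω * noise A att Z Y n j ω =
      (E.indicator (fun _ => (1 : ℝ)) ω - p i ω * p j ω) -
        (p j ω * noise A att Z Y n i ω + p i ω * noise A att Z Y n j ω) := by
    intro ω
    have h1 : E.indicator (fun _ => (1 : ℝ)) ω = Y (n + 1) ω i * Y (n + 1) ω j := by
      rcases hZ.driving_mem n ω i with h | h <;> rcases hZ.driving_mem n ω j with h' | h' <;>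
        simp [hE, Set.indicator, h, h']
    rw [h1]
    simp only [noise, hp]
    ring
  simp_rw [hdecomp]
  have i1 : Integrable (E.indicator fun _ => (1 : ℝ)) μ := (integrable_const _).indicator hEm
  have i2 : Integrable (fun ω => p i ω * p j ω) μ :=
    integrable_of_abs_le ((hpm' i).mul (hpm' j)) (hprod (hp1 i) (hp1 j))
  have i3 : ∀ k l, Integrable (fun ω => p k ω * noise A att Z Y n l ω) μ := fun k l =>
    integrable_of_abs_le ((hpm' k).mul (hξm l)) (hprod (hp1 k) (hZ.abs_noise_le hA hr n l))
  have i4 : Integrable (fun ω => E.indicator (fun _ => (1 : ℝ)) ω - p i ω * p j ω) μ := i1.sub i2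
  have i5 : Integrable (fun ω => p j ω * noise A att Z Y n i ω + p i ω * noise A att Z Y n j ω) μ :=
    (i3 j i).add (i3 i j)
  rw [integral_sub i4 i5, integral_sub i1 i2,
    integral_add (i3 j i) (i3 i j), hEint, hZ.integral_mul_noise hA hr n i (hpm j) (hp1 j),
    hZ.integral_mul_noise hA hr n j (hpm i) (hp1 i)]
  simp

end IsReinforcedSystem

end Noise

end ReinforcedNetwork

namespace ReinforcedNetwork

/-! ### Non-degeneracy of the consensus -/

section NonDegeneracy

variable {V : Type*} [Fintype V] [DecidableEq V] {A : Matrix V V ℝ} {att : V → Attitude}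

/-- An average over a row of a closed class of numbers in `[-1/2, 1/2]` is extremal only if all
the charged numbers are. -/
theorem IsLevelClass.eq_of_sum_extremal (hA : A ∈ Matrix.rowStochastic ℝ V) {R : Finset V}
    (hR : IsLevelClass A 0 R) {u : V → ℝ} (hu : ∀ j ∈ R, |u j| ≤ 1 / 2) {i j : V} (hi : i ∈ R)
    (hj : j ∈ R) (hij : A i j ≠ 0) (h : |∑ j ∈ R, A i j * u j| = 1 / 2) :
    u j = ∑ j ∈ R, A i j * u j := by
  set q := ∑ j ∈ R, A i j * u j with hq
  have hrow : ∑ j ∈ R, A i j = 1 := by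
    have h1 := hR.sum_row hi fun _ => 1
    simp only [mul_one, Finset.range_zero, Finset.sum_empty, add_zero,
      Matrix.sum_row_of_mem_rowStochastic hA] at h1
    exact h1.symm
  have hq2 : q * q = 1 / 4 := by rw [← abs_mul_abs_self, h]; norm_num
  -- The row average of `q * u k` equals its upper bound `q * q = 1 / 4`, so every charged term
  -- attains the bound.
  have hle : ∀ k ∈ R, q * u k ≤ 1 / 4 := by
    intro k hk
    have h1 := le_abs_self (q * u k)
    rw [abs_mul, h] at h1
    linarith [hu k hk]
  have hsum : ∑ k ∈ R, A i k * (1 / 4 - q * u k) = 0 := by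
    have h1 : ∀ k, A i k * (1 / 4 - q * u k) = A i k * (1 / 4) - q * (A i k * u k) := fun k => by
      ring
    simp_rw [h1]
    rw [Finset.sum_sub_distrib, ← Finset.sum_mul, ← Finset.mul_sum, hrow, ← hq, hq2]
    ring
  have h1 := (Finset.sum_eq_zero_iff_of_nonneg fun k hk =>
    mul_nonneg (Matrix.nonneg_of_mem_rowStochastic hA) (by linarith [hle k hk])).1 hsum j hj
  have h2 : q * u j = q * q := by
    have := (mul_eq_zero.1 h1).resolve_left hij
    linarith
  have h3 : q ≠ 0 := fun h0 => by rw [h0, abs_zero] at h; norm_num at h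
  exact mul_left_cancel₀ h3 h2

/-- If two successive states and the driving variables of a closed class are extremal, the
initial state is a consensus. -/
theorem IsLevelClass.consensus_of_extremal (hA : A ∈ Matrix.rowStochastic ℝ V) {R : Finset V}
    (hR : IsLevelClass A 0 R) {ρ : ℝ} (hρ : ρ ∈ Set.Ioo (0 : ℝ) 1) {u u' : V → ℝ}
    (hu : ∀ j ∈ R, |u j| ≤ 1 / 2) (hu' : ∀ j ∈ R, |u' j| ≤ 1 / 2)
    (hq : ∀ i ∈ R, |∑ j ∈ R, A i j * u j| = 1 / 2) (hq' : ∀ i ∈ R, |∑ j ∈ R, A i j * u' j| = 1 / 2)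
    (hstep : ∀ i ∈ R, u' i = (1 - ρ) * u i + ρ * ∑ j ∈ R, A i j * u j) :
    ∀ i ∈ R, |u i| = 1 / 2 ∧ ∀ j ∈ R, u j = u i := by
  have habs : ∀ j ∈ R, |u j| = 1 / 2 ∧ |u' j| = 1 / 2 := by
    intro j hj
    obtain ⟨i, hi, hij⟩ := hR.exists_pos_entry hA hj
    rw [hR.eq_of_sum_extremal hA hu hi hj hij.ne' (hq i hi),
      hR.eq_of_sum_extremal hA hu' hi hj hij.ne' (hq' i hi)]
    exact ⟨hq i hi, hq' i hi⟩
  -- If the average were `-u j`, the next state would be `(1 - 2 * ρ) * u j`, strictly inside the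
  -- interval. The second time step is needed precisely to exclude this.
  have hfix : ∀ j ∈ R, ∑ k ∈ R, A j k * u k = u j := by
    intro j hj
    obtain ⟨h1, h2⟩ := habs j hj
    have h3 := hstep j hj
    rcases (abs_eq (by norm_num)).1 h1 with h4 | h4 <;>
      rcases (abs_eq (by norm_num)).1 (hq j hj) with h5 | h5 <;>
      rcases (abs_eq (by norm_num)).1 h2 with h6 | h6 <;>
      rw [h4, h5, h6] at h3 <;> linarith [hρ.1, hρ.2]
  intro i hi
  refine ⟨(habs i hi).1, fun j hj => ?_⟩
  refine hR.isCommunicatingClass.forall_of_propagates (p := fun j => u j = u i) ?_ hi rfl j hj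
  intro k hk l hl _ hkl hpk
  rw [hR.eq_of_sum_extremal hA hu hk hl hkl (hq k hk), hfix k hk, hpk]

theorem IsSigning.abs_le {R : Finset V} {σ : V → ℝ} (hσ : IsSigning A att R σ) {i : V}
    (hi : i ∈ R) {x : ℝ} (hx : x ∈ Set.Icc (0 : ℝ) 1) : |σ i * (x - 1 / 2)| ≤ 1 / 2 := by
  have h1 : |σ i| = 1 := by rcases hσ.1 i hi with h | h <;> simp [h]
  rw [abs_mul, h1, one_mul, _root_.abs_le]
  constructor <;> linarith [hx.1, hx.2]

variable {Ω : Type*} {mΩ : MeasurableSpace Ω} {μ : Measure Ω} [IsProbabilityMeasure μ]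
  {ℱ : Filtration ℕ mΩ} {r : ℕ → ℝ} {Z Y : ℕ → Ω → V → ℝ}

/-- If the consensus of a closed class is deterministic and the driving variables are
conditionally independent, the noise vanishes on the class and the weighted mean of the states is
constant. -/
theorem IsReinforcedSystem.noise_eq_zero_of_tendsto (hZ : IsReinforcedSystem μ ℱ A att r Z Y)
    (hA : A ∈ Matrix.rowStochastic ℝ V) (hr : ∀ n, r n ∈ Set.Ioo (0 : ℝ) 1) {R : Finset V}
    {σ : V → ℝ} (hσ : IsSigning A att R σ)
    (hind : CondIndepDriving μ ℱ Y R) {v : R → ℝ} (hv0 : ∀ i, 0 < v i)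
    (hv : v ᵥ* block A R R = v) (hv1 : ∑ i, v i = 1) {c : ℝ}
    (hc : ∀ᵐ ω ∂μ, ∀ i ∈ R, Tendsto (fun n => σ i * (Z n ω i - 1 / 2)) atTop (𝓝 c)) :
    (∀ n, ∀ᵐ ω ∂μ, ∀ i ∈ R, noise A att Z Y n i ω = 0) ∧
      ∀ᵐ ω ∂μ, ∑ i : R, v i * (σ i * (Z 0 ω i - 1 / 2)) = c := by
  -- The centred `v`-mean is a martingale up to its starting value: invariance of `v` cancels the
  -- drift, leaving the increment `r n * D n`.
  set W : ℕ → Ω → ℝ := fun n ω => ∑ i : R, v i * (σ i * (Z n ω i - 1 / 2)) - c with hW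
  set D : ℕ → Ω → ℝ := fun n ω => ∑ i : R, v i * σ i * noise A att Z Y n i ω with hD
  have hσ2 : ∀ i : R, σ i * σ i = 1 := fun i => by rcases hσ.1 i i.2 with h | h <;> simp [h]
  have hstep : ∀ n ω, W (n + 1) ω = W n ω + r n * D n ω := by
    intro n ω
    have h1 : ∑ i : R, v i * (σ i * (successProb A att (Z n ω) i - 1 / 2)) =
        ∑ i : R, v i * (σ i * (Z n ω i - 1 / 2)) := by
      have h2 : ∀ i : R, σ i * (successProb A att (Z n ω) i - 1 / 2) =
          ∑ j : R, A i j * (σ j * (Z n ω j - 1 / 2)) := fun i => by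
        rw [hσ.2 _ _ i.2, ← Finset.sum_coe_sort R]
      simp_rw [h2, Finset.mul_sum, ← mul_assoc]
      rw [Finset.sum_comm]
      refine Finset.sum_congr rfl fun j _ => ?_
      simp_rw [← Finset.sum_mul]
      congr 2
      exact congrFun hv j
    have h3 : W (n + 1) ω = W n ω + r n *
        (∑ i : R, v i * (σ i * (successProb A att (Z n ω) i - 1 / 2)) -
          ∑ i : R, v i * (σ i * (Z n ω i - 1 / 2))) + r n * D n ω := by
      have h4 : ∀ i : R, v i * (σ i * (Z (n + 1) ω i - 1 / 2)) =
          v i * (σ i * (Z n ω i - 1 / 2)) + r n *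
            (v i * (σ i * (successProb A att (Z n ω) i - 1 / 2)) -
              v i * (σ i * (Z n ω i - 1 / 2))) + r n * (v i * σ i * noise A att Z Y n i ω) := by
        intro i
        rw [hZ.step_noise]
        ring
      simp only [hW, hD, h4, Finset.sum_add_distrib, ← Finset.mul_sum, Finset.sum_sub_distrib]
      ring
    rw [h3, h1, sub_self, mul_zero, add_zero]
  have hWm : ∀ n, Measurable[ℱ n] (W n) := fun n =>
    (Finset.measurable_fun_sum _ fun (i : R) _ =>
      (((hZ.state_measurable n i).sub_const _).const_mul _).const_mul _).sub_const _
  have hWm' : ∀ n, Measurable (W n) := fun n => (hWm n).mono (ℱ.le n) le_rfl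
  have hWb : ∀ n ω, |W n ω| ≤ 1 / 2 + |c| := by
    intro n ω
    refine (abs_sub _ _).trans (add_le_add ?_ le_rfl)
    calc |∑ i : R, v i * (σ i * (Z n ω i - 1 / 2))|
        ≤ ∑ i : R, |v i * (σ i * (Z n ω i - 1 / 2))| := Finset.abs_sum_le_sum_abs _ _
      _ ≤ ∑ i : R, v i * (1 / 2) := Finset.sum_le_sum fun i _ => by
          rw [abs_mul, abs_of_pos (hv0 i)]
          exact mul_le_mul_of_nonneg_left (hσ.abs_le i.2 (hZ.state_mem_Icc hr n ω i)) (hv0 i).le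
      _ = 1 / 2 := by rw [← Finset.sum_mul, hv1, one_mul]
  have hξm : ∀ n i, Measurable (noise A att Z Y n i) := fun n i =>
    (hZ.noise_measurable n i).mono (ℱ.le _) le_rfl
  have hξξ : ∀ n i j, Integrable (fun ω => noise A att Z Y n i ω * noise A att Z Y n j ω) μ :=
    fun n i j => integrable_of_abs_le ((hξm n i).mul (hξm n j)) (C := 1) fun ω => by
      rw [abs_mul]
      exact mul_le_one₀ (hZ.abs_noise_le hA hr n i ω) (abs_nonneg _) (hZ.abs_noise_le hA hr n j ω)
  have hWξ : ∀ n i, Integrable (fun ω => W n ω * noise A att Z Y n i ω) μ := fun n i =>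
    integrable_of_abs_le ((hWm' n).mul (hξm n i)) (C := 1 / 2 + |c|) fun ω => by
      rw [abs_mul]
      exact (mul_le_of_le_one_right (abs_nonneg _) (hZ.abs_noise_le hA hr n i ω)).trans (hWb n ω)
  have hW2 : ∀ n, Integrable (fun ω => W n ω ^ 2) μ := fun n =>
    integrable_of_abs_le ((hWm' n).pow_const 2) (C := (1 / 2 + |c|) ^ 2) fun ω => by
      rw [abs_pow]; exact pow_le_pow_left₀ (abs_nonneg _) (hWb n ω) 2
  have hWD_eq : ∀ n ω, W n ω * D n ω =
      ∑ i : R, v i * σ i * (W n ω * noise A att Z Y n i ω) := by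
    intro n ω
    simp only [hD, Finset.mul_sum]
    exact Finset.sum_congr rfl fun i _ => by ring
  have hD2_eq : ∀ n ω, D n ω ^ 2 = ∑ i : R, ∑ j : R,
      v i * σ i * (v j * σ j) * (noise A att Z Y n i ω * noise A att Z Y n j ω) := by
    intro n ω
    simp only [hD, pow_two, Finset.sum_mul_sum]
    exact Finset.sum_congr rfl fun i _ => Finset.sum_congr rfl fun j _ => by ring
  have hWD : ∀ n, Integrable (fun ω => W n ω * D n ω) μ := fun n => by
    simp_rw [hWD_eq]
    exact integrable_finsetSum _ fun i _ => (hWξ n i).const_mul _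
  have hD2 : ∀ n, Integrable (fun ω => D n ω ^ 2) μ := fun n => by
    simp_rw [hD2_eq]
    exact integrable_finsetSum _ fun i _ => integrable_finsetSum _ fun j _ =>
      (hξξ n i j).const_mul _
  have hWD0 : ∀ n, ∫ ω, W n ω * D n ω ∂μ = 0 := fun n => by
    simp_rw [hWD_eq]
    rw [integral_finsetSum _ fun (i : R) _ => (hWξ n i).const_mul _]
    refine Finset.sum_eq_zero fun i _ => ?_
    rw [integral_const_mul, hZ.integral_mul_noise hA hr n i (hWm n) (hWb n), mul_zero]
  -- Without the orthogonality of distinct noises, they could compensate in `D` without vanishing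
  -- individually.
  have hD2_int : ∀ n, ∫ ω, D n ω ^ 2 ∂μ =
      ∑ i : R, v i ^ 2 * ∫ ω, noise A att Z Y n i ω ^ 2 ∂μ := fun n => by
    simp_rw [hD2_eq]
    rw [integral_finsetSum _ fun (i : R) _ => integrable_finsetSum _ fun (j : R) _ =>
      (hξξ n i j).const_mul _]
    refine Finset.sum_congr rfl fun i _ => ?_
    rw [integral_finsetSum _ fun (j : R) _ => (hξξ n i j).const_mul _,
      Finset.sum_eq_single_of_mem i (Finset.mem_univ i), integral_const_mul]
    · simp_rw [← pow_two]
      rw [mul_pow, pow_two (σ i), hσ2, mul_one]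
    · intro j _ hji
      rw [integral_const_mul, hZ.integral_noise_mul_noise hA hr hind n i.2 j.2
        (fun h => hji (Subtype.ext h.symm)), mul_zero]
  have hrec : ∀ n, ∫ ω, W (n + 1) ω ^ 2 ∂μ =
      ∫ ω, W n ω ^ 2 ∂μ + r n ^ 2 * ∫ ω, D n ω ^ 2 ∂μ := by
    intro n
    have h1 : ∀ ω, W (n + 1) ω ^ 2 =
        W n ω ^ 2 + (2 * r n * (W n ω * D n ω) + r n ^ 2 * D n ω ^ 2) := by
      intro ω
      rw [hstep]
      ring
    have h2 : Integrable (fun ω => 2 * r n * (W n ω * D n ω) + r n ^ 2 * D n ω ^ 2) μ :=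
      ((hWD n).const_mul _).add ((hD2 n).const_mul _)
    simp_rw [h1]
    rw [integral_add (hW2 n) h2, integral_add ((hWD n).const_mul _) ((hD2 n).const_mul _),
      integral_const_mul, integral_const_mul, hWD0, mul_zero, zero_add]
  have hD2_nonneg : ∀ n, 0 ≤ ∫ ω, D n ω ^ 2 ∂μ := fun n => integral_nonneg fun ω => sq_nonneg _
  have hmono : Monotone fun n => ∫ ω, W n ω ^ 2 ∂μ := monotone_nat_of_le_succ fun n => by
    rw [hrec]
    exact le_add_of_nonneg_right (mul_nonneg (sq_nonneg _) (hD2_nonneg n))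
  have hlim : Tendsto (fun n => ∫ ω, W n ω ^ 2 ∂μ) atTop (𝓝 0) := by
    have h1 := tendsto_integral_of_dominated_convergence (μ := μ) (F := fun n ω => W n ω ^ 2)
      (f := fun _ => 0) (fun _ => (1 / 2 + |c|) ^ 2) (fun n => (hW2 n).aestronglyMeasurable)
      (integrable_const _) (fun n => ae_of_all _ fun ω => by
        rw [norm_pow, Real.norm_eq_abs]; exact pow_le_pow_left₀ (abs_nonneg _) (hWb n ω) 2)
      (by
        filter_upwards [hc] with ω hω
        have h2 : Tendsto (fun n => W n ω) atTop (𝓝 (∑ i : R, v i * c - c)) :=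
          (tendsto_finsetSum _ fun (i : R) _ => (hω i i.2).const_mul (v i)).sub_const c
        rw [← Finset.sum_mul, hv1, one_mul, sub_self] at h2
        simpa using h2.pow 2)
    simpa using h1
  -- A nonnegative nondecreasing sequence with limit zero is identically zero.
  have hW_zero : ∀ n, ∫ ω, W n ω ^ 2 ∂μ = 0 := fun n =>
    le_antisymm (hmono.ge_of_tendsto hlim n) (integral_nonneg fun ω => sq_nonneg _)
  constructor
  · intro n
    have h1 : ∫ ω, D n ω ^ 2 ∂μ = 0 := by
      have h2 := hrec n
      rw [hW_zero, hW_zero, zero_add] at h2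
      exact (mul_eq_zero.1 h2.symm).resolve_left (pow_ne_zero 2 (hr n).1.ne')
    rw [hD2_int] at h1
    have h2 : ∀ i : R, ∀ᵐ ω ∂μ, noise A att Z Y n i ω = 0 := by
      intro i
      have h3 := (Finset.sum_eq_zero_iff_of_nonneg fun (i : R) _ =>
        mul_nonneg (sq_nonneg (v i)) (integral_nonneg fun ω => sq_nonneg _)).1 h1 i
          (Finset.mem_univ i)
      have h4 := (mul_eq_zero.1 h3).resolve_left (pow_ne_zero 2 (hv0 i).ne')
      have h5 : Integrable (fun ω => noise A att Z Y n i ω ^ 2) μ := by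
        simpa [pow_two] using hξξ n i i
      filter_upwards [(integral_eq_zero_iff_of_nonneg (fun ω => sq_nonneg _) h5).1 h4] with ω h6
      exact pow_eq_zero_iff two_ne_zero |>.1 h6
    filter_upwards [ae_all_iff.2 h2] with ω hω i hi
    exact hω ⟨i, hi⟩
  · filter_upwards [(integral_eq_zero_iff_of_nonneg (fun ω => sq_nonneg _) (hW2 0)).1 (hW_zero 0)]
      with ω hω
    exact sub_eq_zero.1 (pow_eq_zero_iff two_ne_zero |>.1 hω)

/-- If the consensus of a closed class is deterministic and the driving variables are
conditionally independent, the initial state is one of the two absorbing configurations. -/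
theorem IsReinforcedSystem.init_trivial_of_tendsto (hZ : IsReinforcedSystem μ ℱ A att r Z Y)
    (hA : A ∈ Matrix.rowStochastic ℝ V) (hr : ∀ n, r n ∈ Set.Ioo (0 : ℝ) 1) {R : Finset V}
    (hR : IsLevelClass A 0 R) {σ : V → ℝ} (hσ : IsSigning A att R σ)
    (hind : CondIndepDriving μ ℱ Y R) {c : ℝ}
    (hc : ∀ᵐ ω ∂μ, ∀ i ∈ R, Tendsto (fun n => σ i * (Z n ω i - 1 / 2)) atTop (𝓝 c)) :
    (∀ᵐ ω ∂μ, ∀ i ∈ R, σ i * (Z 0 ω i - 1 / 2) = -(1 / 2)) ∨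
      ∀ᵐ ω ∂μ, ∀ i ∈ R, σ i * (Z 0 ω i - 1 / 2) = 1 / 2 := by
  obtain ⟨v, hv0, hv, hv1⟩ := hR.exists_invariant hA
  obtain ⟨hξ, hW⟩ := hZ.noise_eq_zero_of_tendsto hA hr hσ hind hv0 hv hv1 hc
  -- Zero noise identifies the success probability with a driving variable in `{0, 1}`, so the
  -- signed averages equal `±1 / 2`.
  have hq : ∀ n ω, (∀ i ∈ R, noise A att Z Y n i ω = 0) → ∀ i ∈ R,
      ∑ j ∈ R, A i j * (σ j * (Z n ω j - 1 / 2)) = σ i * (Y (n + 1) ω i - 1 / 2) := by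
    intro n ω h i hi
    rw [← hσ.2 _ i hi, ← sub_eq_zero.1 (h i hi)]
  have hY : ∀ n ω, ∀ i ∈ R, |σ i * (Y (n + 1) ω i - 1 / 2)| = 1 / 2 := by
    intro n ω i hi
    rcases hσ.1 i hi with h | h <;> rcases hZ.driving_mem n ω i with h' | h' <;>
      rw [h, h'] <;> norm_num [abs_of_pos]
  have hinit : ∀ᵐ ω ∂μ, |c| = 1 / 2 ∧ ∀ i ∈ R, σ i * (Z 0 ω i - 1 / 2) = c := by
    filter_upwards [hξ 0, hξ 1, hW] with ω h0 h1 hWω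
    have hcons := hR.consensus_of_extremal hA (hr 0)
      (u := fun i => σ i * (Z 0 ω i - 1 / 2)) (u' := fun i => σ i * (Z 1 ω i - 1 / 2))
      (fun j hj => hσ.abs_le hj (hZ.state_mem_Icc hr 0 ω j))
      (fun j hj => hσ.abs_le hj (hZ.state_mem_Icc hr 1 ω j))
      (fun i hi => by rw [hq 0 ω h0 i hi]; exact hY 0 ω i hi)
      (fun i hi => by rw [hq 1 ω h1 i hi]; exact hY 1 ω i hi)
      (fun i hi => by rw [hq 0 ω h0 i hi, hZ.step 0 ω i]; ring)
    have hval : ∀ i ∈ R, σ i * (Z 0 ω i - 1 / 2) = c := by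
      intro i hi
      rw [← hWω, Finset.sum_congr rfl fun (j : R) _ => by rw [(hcons i hi).2 j j.2],
        ← Finset.sum_mul, hv1, one_mul]
    obtain ⟨i, hi⟩ := hR.isCommunicatingClass.1
    refine ⟨?_, hval⟩
    rw [← hval i hi]
    exact (hcons i hi).1
  -- As `c` is deterministic, a single sample point decides its sign for almost all of them.
  obtain ⟨ω, hω, -⟩ := hinit.exists
  rcases (abs_eq (by norm_num)).1 hω with h | h
  · exact Or.inr (hinit.mono fun ω h' => h ▸ h'.2)
  · exact Or.inl (hinit.mono fun ω h' => h ▸ h'.2)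

/-- The consensus of a closed class made cooperative by a signing; it is not deterministic if the
driving variables are conditionally independent and the initial state is not trivial. -/
theorem IsReinforcedSystem.exists_consensus (hZ : IsReinforcedSystem μ ℱ A att r Z Y)
    (hA : A ∈ Matrix.rowStochastic ℝ V) (hr : ∀ n, r n ∈ Set.Ioo (0 : ℝ) 1)
    (hr_sum : Tendsto (fun n => ∑ k ∈ Finset.range n, r k) atTop atTop)
    (hr_sq : Summable fun n => r n ^ 2) {Zlim : Ω → V → ℝ} (hlim_meas : Measurable Zlim)
    (hlim : ∀ᵐ ω ∂μ, Tendsto (fun n => Z n ω) atTop (𝓝 (Zlim ω))) {R : Finset V}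
    (hR : IsLevelClass A 0 R) {σ : V → ℝ} (hσ : IsSigning A att R σ) :
    ∃ ζ : Ω → ℝ, Measurable ζ ∧ (∀ᵐ ω ∂μ, ∀ i ∈ R, σ i * (Zlim ω i - 1 / 2) = ζ ω - 1 / 2) ∧
      (CondIndepDriving μ ℱ Y R →
        ¬ (∀ᵐ ω ∂μ, ∀ i ∈ R, σ i * (Z 0 ω i - 1 / 2) = -(1 / 2)) →
        ¬ (∀ᵐ ω ∂μ, ∀ i ∈ R, σ i * (Z 0 ω i - 1 / 2) = 1 / 2) →
        ∀ x : ℝ, μ {ω | ζ ω = x} < 1) := by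
  obtain ⟨i₀, hi₀⟩ := hR.isCommunicatingClass.1
  set ζ : Ω → ℝ := fun ω => σ i₀ * (Zlim ω i₀ - 1 / 2) + 1 / 2 with hζ
  have hζm : Measurable ζ :=
    ((((measurable_pi_apply i₀).comp hlim_meas).sub_const _).const_mul _).add_const _
  have hcons : ∀ᵐ ω ∂μ, ∀ i ∈ R, σ i * (Zlim ω i - 1 / 2) = ζ ω - 1 / 2 := by
    filter_upwards [hlim, hZ.ae_isTrajectory hA hr hr_sum hr_sq] with ω h1 h2 i hi
    obtain ⟨c, hc⟩ := h2.tendsto_of_isSigning hA hR hσ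
    have h3 : ∀ i ∈ R, σ i * (Zlim ω i - 1 / 2) = c := fun i hi =>
      tendsto_nhds_unique (((tendsto_pi_nhds.1 h1 i).sub_const _).const_mul _) (hc i hi)
    rw [h3 i hi, hζ]
    simp only [h3 i₀ hi₀, add_sub_cancel_right]
  refine ⟨ζ, hζm, hcons, fun hind h0 h1 x => lt_of_le_of_ne prob_le_one fun hx => ?_⟩
  have hae : ∀ᵐ ω ∂μ, ζ ω = x :=
    (mem_ae_iff_prob_eq_one (hζm (measurableSet_singleton x))).2 hx
  rcases hZ.init_trivial_of_tendsto hA hr hR hσ hind (c := x - 1 / 2) (by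
    filter_upwards [hlim, hcons, hae] with ω h2 h3 h4 i hi
    rw [← h4, ← h3 i hi]
    exact ((tendsto_pi_nhds.1 h2 i).sub_const _).const_mul _) with h | h
  · exact h0 h
  · exact h1 h

end NonDegeneracy

end ReinforcedNetwork

/-! ### Assembly of the theorem -/

theorem theorem3p3 {V : Type*} [Fintype V] [DecidableEq V]
    {Ω : Type*} {mΩ : MeasurableSpace Ω} (μ : Measure Ω) [IsProbabilityMeasure μ]
    (ℱ : Filtration ℕ mΩ)
    (A : Matrix V V ℝ) (hA : A ∈ Matrix.rowStochastic ℝ V)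
    (att : V → Attitude)
    (r : ℕ → ℝ) (hr : ∀ n, r n ∈ Set.Ioo (0 : ℝ) 1)
    (hr_sum : Tendsto (fun n => ∑ k ∈ Finset.range n, r k) atTop atTop)
    (hr_sq : Summable fun n => r n ^ 2)
    (Z Y : ℕ → Ω → V → ℝ) (hZ : IsReinforcedSystem μ ℱ A att r Z Y)
    (hatt : ∀ m T, IsLevelClass A m T → ∃ a, ∀ i ∈ T, att i = a) :
    -- every agent belongs to exactly one class of the hierarchical representation
    (∀ i, ∃! p : ℕ × Finset V, IsLevelClass A p.1 p.2 ∧ i ∈ p.2) ∧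
    ∃ Zlim : Ω → V → ℝ, Measurable Zlim ∧
      (∀ᵐ ω ∂μ, Tendsto (fun n => Z n ω) atTop (𝓝 (Zlim ω))) ∧
      -- cooperative classes of level 0
      (∀ R, IsLevelClass A 0 R → (∀ i ∈ R, att i = .cooperative) →
        ∃ ζ : Ω → ℝ, Measurable ζ ∧ (∀ᵐ ω ∂μ, ∀ i ∈ R, Zlim ω i = ζ ω) ∧
          (CondIndepDriving μ ℱ Y R →
            ¬ (∀ᵐ ω ∂μ, ∀ i ∈ R, Z 0 ω i = 0) →
            ¬ (∀ᵐ ω ∂μ, ∀ i ∈ R, Z 0 ω i = 1) →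
            ∀ x : ℝ, μ {ω | ζ ω = x} < 1)) ∧
      -- competitive bipartite classes of level 0
      (∀ R, IsLevelClass A 0 R → (∀ i ∈ R, att i = .competitive) →
        ∀ I J, IsBipartition A R I J →
        ∃ ζ : Ω → ℝ, Measurable ζ ∧
          (∀ᵐ ω ∂μ, (∀ i ∈ I, Zlim ω i = ζ ω) ∧ ∀ j ∈ J, Zlim ω j = 1 - ζ ω) ∧
          (CondIndepDriving μ ℱ Y R →
            ¬ (∀ᵐ ω ∂μ, (∀ i ∈ I, Z 0 ω i = 0) ∧ ∀ j ∈ J, Z 0 ω j = 1) →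
            ¬ (∀ᵐ ω ∂μ, (∀ i ∈ I, Z 0 ω i = 1) ∧ ∀ j ∈ J, Z 0 ω j = 0) →
            ∀ x : ℝ, μ {ω | ζ ω = x} < 1)) ∧
      -- competitive non-bipartite classes of level 0
      (∀ R, IsLevelClass A 0 R → (∀ i ∈ R, att i = .competitive) → ¬ IsBipartiteOn A R →
        ∀ᵐ ω ∂μ, ∀ i ∈ R, Zlim ω i = 1 / 2) ∧
      -- classes of higher level
      (∀ m, 1 ≤ m → ∀ T, IsLevelClass A m T → ∀ a, (∀ i ∈ T, att i = a) →
        IsUnit (driftMatrix A T a) ∧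
        ∀ᵐ ω ∂μ, blockVec T (Zlim ω) =
          -((driftMatrix A T a)⁻¹ *ᵥ
            (driftConst A T a +
              ∑ t ∈ Finset.range m, ∑ S ∈ levelClasses A t,
                influence A T S a *ᵥ blockVec S (Zlim ω)))) := by
  have hA0 : ∀ i j, 0 ≤ A i j := fun _ _ => Matrix.nonneg_of_mem_rowStochastic hA
  have htraj := hZ.ae_isTrajectory hA hr hr_sum hr_sq
  obtain ⟨Zlim, hmeas, hlim⟩ := measurable_limit_of_tendsto_metrizable_ae (μ := μ)
    (f := Z) (L := atTop)
    (fun n => (measurable_pi_lambda _ fun i =>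
      (hZ.state_measurable n i).mono (ℱ.le n) le_rfl).aemeasurable)
    (htraj.mono fun ω h => h.exists_tendsto hA hatt)
  refine ⟨existsUnique_isLevelClass hA0, Zlim, hmeas, hlim, ?_, ?_, ?_, ?_⟩
  · intro R hR ha
    obtain ⟨ζ, hζ, hcons, hnd⟩ := hZ.exists_consensus hA hr hr_sum hr_sq hmeas hlim hR
      (hR.isSigning_of_cooperative hA ha)
    refine ⟨ζ, hζ, ?_, fun hind h0 h1 => hnd hind (fun h => h0 ?_) fun h => h1 ?_⟩
    · filter_upwards [hcons] with ω h i hi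
      linarith [h i hi]
    · filter_upwards [h] with ω h i hi
      linarith [h i hi]
    · filter_upwards [h] with ω h i hi
      linarith [h i hi]
  · intro R hR ha I J hIJ
    obtain ⟨ζ, hζ, hcons, hnd⟩ := hZ.exists_consensus hA hr hr_sum hr_sq hmeas hlim hR
      (hR.isSigning_of_isBipartition hA ha hIJ)
    have hsplit : ∀ {y : V → ℝ} {x : ℝ},
        (∀ i ∈ R, (if i ∈ I then (1 : ℝ) else -1) * (y i - 1 / 2) = x - 1 / 2) →
          (∀ i ∈ I, y i = x) ∧ ∀ j ∈ J, y j = 1 - x := by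
      intro y x h
      refine ⟨fun i hi => ?_, fun j hj => ?_⟩
      · have h1 := h i ((hIJ.1 i).2 (Or.inl hi))
        rw [if_pos hi] at h1
        linarith
      · have h1 := h j ((hIJ.1 j).2 (Or.inr hj))
        rw [if_neg fun hi => Finset.disjoint_left.1 hIJ.2.1 hi hj] at h1
        linarith
    refine ⟨ζ, hζ, hcons.mono fun ω h => hsplit h, fun hind h0 h1 =>
      hnd hind (fun h => h0 ?_) fun h => h1 ?_⟩
    · filter_upwards [h] with ω h
      have h2 := hsplit (x := 0) fun i hi => (h i hi).trans (by norm_num)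
      simpa using h2
    · filter_upwards [h] with ω h
      have h2 := hsplit (x := 1) fun i hi => (h i hi).trans (by norm_num)
      simpa using h2
  · intro R hR ha hbip
    filter_upwards [hlim, htraj] with ω h1 h2
    exact h2.eq_half_of_not_bipartite hA hR ha hbip h1
  · intro m hm T hT a ha
    refine ⟨hT.isUnit_driftMatrix hA hm a, ?_⟩
    filter_upwards [hlim, htraj] with ω h1 h2
    have h3 := h2.tendsto_blockVec hA hT ha (hT.isUnit_driftMatrix hA hm a)
      fun t _ S _ j _ => tendsto_pi_nhds.1 h1 j
    exact tendsto_nhds_unique (tendsto_pi_nhds.2 fun i : T => tendsto_pi_nhds.1 h1 i) h3
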